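/- Let $\mathcal H = L^2(0,1)\times L^2(0,1)$ (complex valued functions), with inner product $(\mathbf u|\mathbf v)_{\mathcal H}=(u_1|v_1)_{L^2}+(u_2|v_2)_{L^2}$. Define the operator $\tilde L_0$ in $\mathcal H$ by $$\mathcal D(\tilde L_0)=\{\mathbf u\in C^1[0,1]\times C^1[0,1]: u_1(0)=0\},\qquad \tilde L_0\mathbf u(\rho)=\begin{pmatrix}-\rho u_1'(\rho)+u_2'(\rho)\\ u_1'(\rho)-\rho u_2'(\rho)\end{pmatrix}.$$ For $k\in\mathbb N_0$ let $$\mathcal H^{2k}=\{\mathbf u\in H^{2k}(0,1)\times H^{2k}(0,1): u_1^{(2j)}(0)=u_2^{(2j+1)}(0)=0 \text{ for all integers } 0\le j<k\},$$ where the boundary values are those of the continuous representatives, equipped with the inner product $(\mathbf u|\mathbf v)_{\mathcal H^{2k}}=(\mathbf u|\mathbf v)_{\mathcal H}+(\mathbf u^{(2k)}|\mathbf v^{(2k)})_{\mathcal H}$. Proposition. The operator $\tilde L_0$ is closable; let $L_0$ be its closure. For every $k\in\mathbb N_0$, $\mathcal H^{2k}$ is a Hilbert space, and the part $L_{0,k}$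 of $L_0$ in $\mathcal H^{2k}$, i.e. the operator $$\mathcal D(L_{0,k})=\{\mathbf u\in\mathcal D(L_0)\cap\mathcal H^{2k}: L_0\mathbf u\in\mathcal H^{2k}\},\qquad L_{0,k}\mathbf u=L_0\mathbf u,$$ is the generator of a strongly continuous one-parameter semigroup $S_{0,k}:[0,\infty)\to\mathcal B(\mathcal H^{2k})$ with $$\|S_{0,k}(\tau)\|_{\mathcal B(\mathcal H^{2k})}\le e^{\tau/2}\qquad\text{for all }\tau\ge 0.$$ -/

import Mathlib

open MeasureTheory Set Filter Topology
open scoped NNReal ContDiff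

noncomputable section

namespace SimWave

/-! ### The energy space `L²(0,1) × L²(0,1)` -/

/-- Lebesgue measure on the open interval `(0,1)`. -/
abbrev mu : Measure ℝ := volume.restrict (Ioo (0 : ℝ) 1)

/-- The complex Hilbert space `L²(0,1)`. -/
abbrev L2 : Type := Lp ℂ 2 mu

/-- The Hilbert space `𝓗 = L²(0,1) × L²(0,1)` with
`(u|v) = (u₁|v₁) + (u₂|v₂)`. -/
abbrev H : Type := WithLp 2 (L2 × L2)

/-! ### Weak derivatives and Sobolev spaces on `(0,1)` -/

/-- `g` is the `j`-th weak derivative of `f` on `(0,1)`. -/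
def IsWeakDeriv (j : ℕ) (f g : L2) : Prop :=
  ∀ φ : ℝ → ℝ, ContDiff ℝ ∞ φ → HasCompactSupport φ → tsupport φ ⊆ Ioo (0 : ℝ) 1 →
    ∫ x in Ioo (0 : ℝ) 1, iteratedDeriv j φ x • f x =
      (-1 : ℂ) ^ j * ∫ x in Ioo (0 : ℝ) 1, φ x • g x

theorem integrable_test (f : L2) {φ : ℝ → ℝ} (hφ : Continuous φ) (hc : HasCompactSupport φ) :
    Integrable (fun x => φ x • f x) mu := by
  have hf : Integrable (f : ℝ → ℂ) mu := (Lp.memLp f).integrable (by norm_num)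
  obtain ⟨C, hC⟩ := hφ.bounded_above_of_compact_support hc
  exact hf.bdd_smul C hφ.aestronglyMeasurable (Eventually.of_forall hC)

theorem integrable_test_deriv (j : ℕ) (f : L2) {φ : ℝ → ℝ} (hφ : ContDiff ℝ ∞ φ)
    (hc : HasCompactSupport φ) : Integrable (fun x => iteratedDeriv j φ x • f x) mu := by
  refine integrable_test f (hφ.continuous_iteratedDeriv j (by exact_mod_cast le_top)) ?_
  have : iteratedDeriv j φ = (fun m : ContinuousMultilinearMap ℝ (fun _ : Fin j => ℝ) ℝ =>
      m fun _ => 1) ∘ iteratedFDeriv ℝ j φ := by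
    ext x; rfl
  rw [this]
  exact (hc.iteratedFDeriv j).comp_left (by simp)

theorem IsWeakDeriv.add {j : ℕ} {f g f' g' : L2} (h : IsWeakDeriv j f g)
    (h' : IsWeakDeriv j f' g') : IsWeakDeriv j (f + f') (g + g') := by
  intro φ hφ hc hs
  have e1 : ∫ x in Ioo (0 : ℝ) 1, iteratedDeriv j φ x • (f + f' : L2) x =
      ∫ x in Ioo (0 : ℝ) 1, (iteratedDeriv j φ x • f x + iteratedDeriv j φ x • f' x) :=
    integral_congr_ae (by
      filter_upwards [Lp.coeFn_add f f'] with x hx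
      rw [hx, Pi.add_apply, smul_add])
  have e2 : ∫ x in Ioo (0 : ℝ) 1, φ x • (g + g' : L2) x =
      ∫ x in Ioo (0 : ℝ) 1, (φ x • g x + φ x • g' x) :=
    integral_congr_ae (by
      filter_upwards [Lp.coeFn_add g g'] with x hx
      rw [hx, Pi.add_apply, smul_add])
  rw [e1, e2, integral_add (integrable_test_deriv j f hφ hc) (integrable_test_deriv j f' hφ hc),
    integral_add (integrable_test g hφ.continuous hc) (integrable_test g' hφ.continuous hc),
    h φ hφ hc hs, h' φ hφ hc hs, mul_add]

theorem IsWeakDeriv.smul {j : ℕ} {f g : L2} (c : ℂ) (h : IsWeakDeriv j f g) :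
    IsWeakDeriv j (c • f) (c • g) := by
  intro φ hφ hc hs
  have e1 : ∫ x in Ioo (0 : ℝ) 1, iteratedDeriv j φ x • (c • f : L2) x =
      ∫ x in Ioo (0 : ℝ) 1, c • (iteratedDeriv j φ x • f x) :=
    integral_congr_ae (by
      filter_upwards [Lp.coeFn_smul c f] with x hx
      rw [hx, Pi.smul_apply, smul_comm])
  have e2 : ∫ x in Ioo (0 : ℝ) 1, φ x • (c • g : L2) x =
      ∫ x in Ioo (0 : ℝ) 1, c • (φ x • g x) :=
    integral_congr_ae (by
      filter_upwards [Lp.coeFn_smul c g] with x hx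
      rw [hx, Pi.smul_apply, smul_comm])
  rw [e1, e2, integral_smul, integral_smul, h φ hφ hc hs, smul_eq_mul, smul_eq_mul]
  ring

theorem IsWeakDeriv.zero (j : ℕ) : IsWeakDeriv j 0 0 := by
  intro φ hφ hc hs
  have e (ψ : ℝ → ℝ) : ∫ x in Ioo (0 : ℝ) 1, ψ x • (0 : L2) x = 0 := by
    rw [integral_congr_ae (g := fun _ => (0 : ℂ)), integral_zero]
    filter_upwards [Lp.coeFn_zero ℂ 2 mu] with x hx
    rw [hx]; simp
  rw [e, e, mul_zero]

/-- Weak derivatives are unique. -/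
theorem IsWeakDeriv.eq_zero {j : ℕ} {g : L2} (h : IsWeakDeriv j 0 g) : g = 0 := by
  have hg : Integrable (g : ℝ → ℂ) mu := (Lp.memLp g).integrable (by norm_num)
  have key : ∀ᵐ x ∂(volume : Measure ℝ), x ∈ Ioo (0 : ℝ) 1 → g x = 0 := by
    refine isOpen_Ioo.ae_eq_zero_of_integral_contDiff_smul_eq_zero
      (IntegrableOn.locallyIntegrableOn hg) ?_
    intro φ hφ hc hs
    have h1 := h φ hφ hc hs
    have e : ∫ x in Ioo (0 : ℝ) 1, iteratedDeriv j φ x • (0 : L2) x = 0 := by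
      rw [integral_congr_ae (g := fun _ => (0 : ℂ)), integral_zero]
      filter_upwards [Lp.coeFn_zero ℂ 2 mu] with x hx
      rw [hx]; simp
    rw [e, eq_comm, mul_eq_zero, or_iff_right (by simp)] at h1
    rw [← h1, eq_comm]
    refine setIntegral_eq_integral_of_forall_compl_eq_zero fun x hx => ?_
    rw [image_eq_zero_of_notMem_tsupport fun hx' => hx (hs hx'), zero_smul]
  rw [Lp.eq_zero_iff_ae_eq_zero]
  exact (ae_restrict_iff' measurableSet_Ioo).2 key

/-- The graph of the `j`-th weak derivative in `L²(0,1)`. -/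
def weakDerivGraph (j : ℕ) : Submodule ℂ (L2 × L2) where
  carrier := {p | IsWeakDeriv j p.1 p.2}
  add_mem' := fun h h' => h.add h'
  zero_mem' := IsWeakDeriv.zero j
  smul_mem' := fun c _ h => h.smul c

/-- The `j`-th weak derivative as an operator in `L²(0,1)`; its domain consists of all
`f ∈ L²(0,1)` that have a `j`-th weak derivative in `L²(0,1)`. -/
def weakDeriv (j : ℕ) : L2 →ₗ.[ℂ] L2 := (weakDerivGraph j).toLinearPMap

theorem mem_weakDeriv_graph {j : ℕ} {f g : L2} :
    (f, g) ∈ (weakDeriv j).graph ↔ IsWeakDeriv j f g := by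
  rw [weakDeriv, Submodule.toLinearPMap_graph_eq]
  · rfl
  · rintro ⟨f, g⟩ hp (rfl : f = 0)
    exact IsWeakDeriv.eq_zero hp

/-- The Sobolev space `H^m(0,1)`: all weak derivatives up to order `m` exist in `L²(0,1)`. -/
def sobolev (m : ℕ) : Submodule ℂ L2 where
  carrier := {f | ∀ j ≤ m, f ∈ (weakDeriv j).domain}
  add_mem' := fun h h' j hj => Submodule.add_mem _ (h j hj) (h' j hj)
  zero_mem' := fun _ _ => Submodule.zero_mem _
  smul_mem' := fun c _ h j hj => Submodule.smul_mem _ c (h j hj)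

/-- `f` has a representative that is continuous on `[0,1]` and vanishes at `0`. -/
def VanishesAtZero (f : L2) : Prop :=
  ∃ g : ℝ → ℂ, ContinuousOn g (Icc 0 1) ∧ f =ᵐ[mu] g ∧ g 0 = 0

/-- The space of all `f` whose `j`-th weak derivative exists in `L²(0,1)` and satisfies
`f^{(j)}(0) = 0`, the value being that of the continuous representative. -/
def zeroTrace (j : ℕ) : Submodule ℂ L2 where
  carrier := {f | ∃ g : L2, IsWeakDeriv j f g ∧ VanishesAtZero g}
  add_mem' := by
    rintro f f' ⟨g, h, G, hG, e, h0⟩ ⟨g', h', G', hG', e', h0'⟩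
    refine ⟨g + g', h.add h', G + G', hG.add hG', ?_, by simp [h0, h0']⟩
    exact (Lp.coeFn_add g g').trans (e.add e')
  zero_mem' := ⟨0, IsWeakDeriv.zero j, 0, continuousOn_const, Lp.coeFn_zero ℂ 2 mu, rfl⟩
  smul_mem' := by
    rintro c f ⟨g, h, G, hG, e, h0⟩
    refine ⟨c • g, h.smul c, c • G, hG.const_smul c, ?_, by simp [h0]⟩
    exact (Lp.coeFn_smul c g).trans (e.const_smul c)

/-! ### The spaces `𝓗^{2k}` -/

/-- `𝓗^{2k}` as a linear subspace of `𝓗`: all `u ∈ H^{2k}(0,1) × H^{2k}(0,1)` with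
`u₁^{(2j)}(0) = u₂^{(2j+1)}(0) = 0` for all `j < k`. -/
def hSub (k : ℕ) : Submodule ℂ H where
  carrier := {u | u.fst ∈ sobolev (2 * k) ∧ u.snd ∈ sobolev (2 * k) ∧
    ∀ j < k, u.fst ∈ zeroTrace (2 * j) ∧ u.snd ∈ zeroTrace (2 * j + 1)}
  add_mem' := fun h h' => ⟨Submodule.add_mem _ h.1 h'.1, Submodule.add_mem _ h.2.1 h'.2.1,
    fun j hj => ⟨Submodule.add_mem _ (h.2.2 j hj).1 (h'.2.2 j hj).1,
      Submodule.add_mem _ (h.2.2 j hj).2 (h'.2.2 j hj).2⟩⟩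
  zero_mem' := ⟨Submodule.zero_mem _, Submodule.zero_mem _,
    fun _ _ => ⟨Submodule.zero_mem _, Submodule.zero_mem _⟩⟩
  smul_mem' := fun c _ h => ⟨Submodule.smul_mem _ c h.1, Submodule.smul_mem _ c h.2.1,
    fun j hj => ⟨Submodule.smul_mem _ c (h.2.2 j hj).1, Submodule.smul_mem _ c (h.2.2 j hj).2⟩⟩

/-- The space `𝓗^{2k}` as a type of its own (it carries a norm other than that of `𝓗`). -/
def HSpace (k : ℕ) : Type := hSub k

instance (k : ℕ) : AddCommGroup (HSpace k) := inferInstanceAs (AddCommGroup (hSub k))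

instance (k : ℕ) : Module ℂ (HSpace k) := inferInstanceAs (Module ℂ (hSub k))

/-- The inclusion `𝓗^{2k} ⊂ 𝓗`. -/
def incl (k : ℕ) : HSpace k →ₗ[ℂ] H := (hSub k).subtype

theorem incl_injective (k : ℕ) : Function.Injective (incl k) := (hSub k).injective_subtype

theorem range_incl (k : ℕ) : LinearMap.range (incl k) = hSub k := (hSub k).range_subtype

/-- The operator `D^{2k} : 𝓗^{2k} → 𝓗`, `D^{2k} u = (u₁^{(2k)}, u₂^{(2k)})`. -/
def D2k (k : ℕ) : HSpace k →ₗ[ℂ] H where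
  toFun u := WithLp.toLp 2
    (weakDeriv (2 * k) ⟨(incl k u).fst, u.2.1 (2 * k) le_rfl⟩,
     weakDeriv (2 * k) ⟨(incl k u).snd, u.2.2.1 (2 * k) le_rfl⟩)
  map_add' u v := by
    rw [← WithLp.toLp_add, Prod.mk_add_mk, ← LinearPMap.map_add, ← LinearPMap.map_add]
    rfl
  map_smul' c u := by
    rw [RingHom.id_apply, ← WithLp.toLp_smul, Prod.smul_mk, ← LinearPMap.map_smul,
      ← LinearPMap.map_smul]
    rfl

/-- The inner product `(u|v)_{𝓗^{2k}} = (u|v)_𝓗 + (D^{2k} u|D^{2k} v)_𝓗`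
(antilinear in the first argument). -/
@[reducible]
def hCore (k : ℕ) : InnerProductSpace.Core ℂ (HSpace k) where
  inner u v := inner ℂ (incl k u) (incl k v) + inner ℂ (D2k k u) (D2k k v)
  conj_inner_symm u v := by
    rw [map_add, inner_conj_symm, inner_conj_symm]
  re_inner_nonneg u := by
    rw [map_add]
    exact add_nonneg inner_self_nonneg inner_self_nonneg
  add_left u v w := by
    rw [map_add, map_add, inner_add_left, inner_add_left]
    ring
  smul_left u v c := by
    rw [map_smul, map_smul, inner_smul_left, inner_smul_left, mul_add]
  definite u h := by
    have h3 : 0 ≤ RCLike.re (inner ℂ (D2k k u) (D2k k u)) := inner_self_nonneg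
    have h1 := congrArg RCLike.re h
    rw [map_add, map_zero] at h1
    have h4 : RCLike.re (inner ℂ (incl k u) (incl k u)) ≤ 0 := by linarith
    rw [inner_self_eq_norm_sq] at h4
    have h5 : incl k u = 0 := by
      rw [← norm_eq_zero]
      nlinarith [norm_nonneg (incl k u)]
    exact incl_injective k (h5.trans (map_zero _).symm)

instance (k : ℕ) : NormedAddCommGroup (HSpace k) := (hCore k).toNormedAddCommGroup

instance (k : ℕ) : InnerProductSpace ℂ (HSpace k) :=
  InnerProductSpace.ofCore (hCore k).toCore

theorem inner_def (k : ℕ) (u v : HSpace k) :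
    inner ℂ u v = inner ℂ (incl k u) (incl k v) + inner ℂ (D2k k u) (D2k k v) := rfl

/-! ### The operators `L̃₀`, `L₀` and `L_{0,k}` -/

/-- `g₁, g₂ ∈ C¹[0,1]` with `g₁(0) = 0` represent `u ∈ 𝓗`. -/
def IsC1Rep (u : H) (g₁ g₂ : ℝ → ℂ) : Prop :=
  ContDiffOn ℝ 1 g₁ (Icc 0 1) ∧ ContDiffOn ℝ 1 g₂ (Icc 0 1) ∧ g₁ 0 = 0 ∧
    u.fst =ᵐ[mu] g₁ ∧ u.snd =ᵐ[mu] g₂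

/-- The derivative of a function on `[0,1]` (one-sided at the end points). -/
abbrev der (g : ℝ → ℂ) : ℝ → ℂ := derivWithin g (Icc 0 1)

/-- The relation `v = L̃₀ u`: for some representatives `g₁, g₂ ∈ C¹[0,1]` of `u` with
`g₁(0) = 0`, one has `v₁ = -ρ g₁' + g₂'` and `v₂ = g₁' - ρ g₂'`. -/
def IsLtilde (u v : H) : Prop :=
  ∃ g₁ g₂ : ℝ → ℂ, IsC1Rep u g₁ g₂ ∧
    v.fst =ᵐ[mu] (fun ρ => -(ρ : ℂ) * der g₁ ρ + der g₂ ρ) ∧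
    v.snd =ᵐ[mu] (fun ρ => der g₁ ρ - (ρ : ℂ) * der g₂ ρ)

theorem IsLtilde.add {u v u' v' : H} (h : IsLtilde u v) (h' : IsLtilde u' v') :
    IsLtilde (u + u') (v + v') := by
  obtain ⟨g₁, g₂, ⟨c1, c2, z, e1, e2⟩, d1, d2⟩ := h
  obtain ⟨f₁, f₂, ⟨c1', c2', z', e1', e2'⟩, d1', d2'⟩ := h'
  have hd : ∀ g f : ℝ → ℂ, ContDiffOn ℝ 1 g (Icc 0 1) → ContDiffOn ℝ 1 f (Icc 0 1) →
      ∀ x ∈ Ioo (0 : ℝ) 1, der (g + f) x = der g x + der f x := fun g f hg hf x hx =>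
    derivWithin_add (hg.differentiableOn one_ne_zero x (Ioo_subset_Icc_self hx))
      (hf.differentiableOn one_ne_zero x (Ioo_subset_Icc_self hx))
  refine ⟨g₁ + f₁, g₂ + f₂, ⟨c1.add c1', c2.add c2', by simp [z, z'],
    (Lp.coeFn_add _ _).trans (e1.add e1'), (Lp.coeFn_add _ _).trans (e2.add e2')⟩, ?_, ?_⟩
  · filter_upwards [Lp.coeFn_add v.fst v'.fst, d1, d1', ae_restrict_mem measurableSet_Ioo]
      with x hx h1 h2 hm
    rw [WithLp.add_fst, hx, Pi.add_apply, h1, h2, hd _ _ c1 c1' x hm, hd _ _ c2 c2' x hm]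
    ring
  · filter_upwards [Lp.coeFn_add v.snd v'.snd, d2, d2', ae_restrict_mem measurableSet_Ioo]
      with x hx h1 h2 hm
    rw [WithLp.add_snd, hx, Pi.add_apply, h1, h2, hd _ _ c1 c1' x hm, hd _ _ c2 c2' x hm]
    ring

theorem IsLtilde.smul {u v : H} (c : ℂ) (h : IsLtilde u v) : IsLtilde (c • u) (c • v) := by
  obtain ⟨g₁, g₂, ⟨c1, c2, z, e1, e2⟩, d1, d2⟩ := h
  have hd : ∀ g : ℝ → ℂ, ContDiffOn ℝ 1 g (Icc 0 1) →
      ∀ x ∈ Ioo (0 : ℝ) 1, der (c • g) x = c * der g x := fun g hg x hx =>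
    derivWithin_const_smul c (hg.differentiableOn one_ne_zero x (Ioo_subset_Icc_self hx))
  refine ⟨c • g₁, c • g₂, ⟨c1.const_smul c, c2.const_smul c, by simp [z],
    (Lp.coeFn_smul _ _).trans (e1.const_smul c), (Lp.coeFn_smul _ _).trans (e2.const_smul c)⟩,
    ?_, ?_⟩
  · filter_upwards [Lp.coeFn_smul c v.fst, d1, ae_restrict_mem measurableSet_Ioo] with x hx h1 hm
    rw [WithLp.smul_fst, hx, Pi.smul_apply, h1, hd _ c1 x hm, hd _ c2 x hm, smul_eq_mul]
    ring
  · filter_upwards [Lp.coeFn_smul c v.snd, d2, ae_restrict_mem measurableSet_Ioo] with x hx h1 hm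
    rw [WithLp.smul_snd, hx, Pi.smul_apply, h1, hd _ c1 x hm, hd _ c2 x hm, smul_eq_mul]
    ring

theorem IsLtilde.zero : IsLtilde 0 0 := by
  refine ⟨0, 0, ⟨contDiffOn_const, contDiffOn_const, rfl, Lp.coeFn_zero ℂ 2 mu,
    Lp.coeFn_zero ℂ 2 mu⟩, ?_, ?_⟩
  all_goals
    refine (Lp.coeFn_zero ℂ 2 mu).trans (Eventually.of_forall fun x => ?_)
    simp [der]

theorem IsLtilde.eq_zero {v : H} (h : IsLtilde 0 v) : v = 0 := by
  obtain ⟨g₁, g₂, ⟨c1, c2, z, e1, e2⟩, d1, d2⟩ := h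
  have hd : ∀ g : ℝ → ℂ, ContDiffOn ℝ 1 g (Icc 0 1) → ((0 : L2) : ℝ → ℂ) =ᵐ[mu] g →
      ∀ x ∈ Ioo (0 : ℝ) 1, der g x = 0 := by
    intro g hg he x hx
    have e : EqOn g 0 (Ioo (0 : ℝ) 1) := Measure.eqOn_Ioo_of_ae_eq volume
      (he.symm.trans (Lp.coeFn_zero ℂ 2 mu)) (hg.continuousOn.mono Ioo_subset_Icc_self)
      continuousOn_const
    have e' : g =ᶠ[𝓝 x] fun _ => 0 := e.eventuallyEq_of_mem (isOpen_Ioo.mem_nhds hx)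
    rw [der, derivWithin_of_mem_nhds (Icc_mem_nhds hx.1 hx.2), e'.deriv_eq, deriv_const]
  have k1 : v.fst = 0 := by
    rw [Lp.eq_zero_iff_ae_eq_zero]
    filter_upwards [d1, ae_restrict_mem measurableSet_Ioo] with x h1 hm
    rw [h1, hd _ c1 e1 x hm, hd _ c2 e2 x hm]; simp
  have k2 : v.snd = 0 := by
    rw [Lp.eq_zero_iff_ae_eq_zero]
    filter_upwards [d2, ae_restrict_mem measurableSet_Ioo] with x h1 hm
    rw [h1, hd _ c1 e1 x hm, hd _ c2 e2 x hm]; simp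
  exact WithLp.ofLp_injective 2 (Prod.ext k1 k2)

/-- The graph of `L̃₀`. -/
def LtildeGraph : Submodule ℂ (H × H) where
  carrier := {p | IsLtilde p.1 p.2}
  add_mem' := fun h h' => h.add h'
  zero_mem' := IsLtilde.zero
  smul_mem' := fun c _ h => h.smul c

/-- The operator `L̃₀ u = (-ρ u₁' + u₂', u₁' - ρ u₂')` in `𝓗` with domain
`{u ∈ C¹[0,1] × C¹[0,1] : u₁(0) = 0}`. -/
def Ltilde : H →ₗ.[ℂ] H := LtildeGraph.toLinearPMap

theorem mem_Ltilde_graph {u v : H} : (u, v) ∈ Ltilde.graph ↔ IsLtilde u v := by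
  rw [Ltilde, Submodule.toLinearPMap_graph_eq]
  · rfl
  · rintro ⟨u, v⟩ hp (rfl : u = 0)
    exact IsLtilde.eq_zero hp

/-- A function that is continuous on `[0,1]` defines an element of `L²(0,1)`. -/
theorem memLp_of_continuousOn {g : ℝ → ℂ} (hg : ContinuousOn g (Icc 0 1)) : MemLp g 2 mu := by
  obtain ⟨C, hC⟩ := isCompact_Icc.exists_bound_of_continuousOn hg
  refine MemLp.of_bound
    ((hg.mono Ioo_subset_Icc_self).aestronglyMeasurable measurableSet_Ioo) C ?_
  filter_upwards [ae_restrict_mem measurableSet_Ioo] with x hx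
  exact hC x (Ioo_subset_Icc_self hx)

theorem mem_Ltilde_domain {u : H} : u ∈ Ltilde.domain ↔ ∃ g₁ g₂ : ℝ → ℂ, IsC1Rep u g₁ g₂ := by
  rw [LinearPMap.mem_domain_iff]
  constructor
  · rintro ⟨v, hv⟩
    obtain ⟨g₁, g₂, h, -⟩ := mem_Ltilde_graph.1 hv
    exact ⟨g₁, g₂, h⟩
  · rintro ⟨g₁, g₂, h⟩
    have k1 := h.1.continuousOn_derivWithin (uniqueDiffOn_Icc zero_lt_one) le_rfl
    have k2 := h.2.1.continuousOn_derivWithin (uniqueDiffOn_Icc zero_lt_one) le_rfl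
    have k0 : ContinuousOn (fun ρ : ℝ => (ρ : ℂ)) (Icc 0 1) :=
      Complex.continuous_ofReal.continuousOn
    have m1 : MemLp (fun ρ : ℝ => -(ρ : ℂ) * der g₁ ρ + der g₂ ρ) 2 mu :=
      memLp_of_continuousOn ((k0.neg.mul k1).add k2)
    have m2 : MemLp (fun ρ : ℝ => der g₁ ρ - (ρ : ℂ) * der g₂ ρ) 2 mu :=
      memLp_of_continuousOn (k1.sub (k0.mul k2))
    exact ⟨WithLp.toLp 2 (m1.toLp, m2.toLp),
      mem_Ltilde_graph.2 ⟨g₁, g₂, h, m1.coeFn_toLp, m2.coeFn_toLp⟩⟩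

/-- The closure `L₀` of `L̃₀` in `𝓗`. -/
def L0 : H →ₗ.[ℂ] H := Ltilde.closure

/-- The graph of the part of `L₀` in `𝓗^{2k}`: the pairs `u, v ∈ 𝓗^{2k}` with
`u ∈ 𝓓(L₀)` and `L₀ u = v`. -/
def L0kGraph (k : ℕ) : Submodule ℂ (HSpace k × HSpace k) :=
  L0.graph.comap ((incl k).prodMap (incl k))

/-- The part `L_{0,k}` of `L₀` in `𝓗^{2k}`. -/
def L0k (k : ℕ) : HSpace k →ₗ.[ℂ] HSpace k := (L0kGraph k).toLinearPMap

theorem mem_L0k_graph {k : ℕ} {u v : HSpace k} :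
    (u, v) ∈ (L0k k).graph ↔ (incl k u, incl k v) ∈ L0.graph := by
  rw [L0k, Submodule.toLinearPMap_graph_eq]
  · rfl
  · rintro ⟨u, v⟩ hp (rfl : u = 0)
    refine incl_injective k ((L0.graph_fst_eq_zero_snd hp ?_).trans (map_zero _).symm)
    exact map_zero (incl k)

/-- The domain of `L_{0,k}` is `{u ∈ 𝓓(L₀) ∩ 𝓗^{2k} : L₀ u ∈ 𝓗^{2k}}`. -/
theorem mem_L0k_domain {k : ℕ} {u : HSpace k} :
    u ∈ (L0k k).domain ↔ ∃ h : incl k u ∈ L0.domain, L0 ⟨incl k u, h⟩ ∈ hSub k := by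
  rw [LinearPMap.mem_domain_iff]
  constructor
  · rintro ⟨v, hv⟩
    obtain ⟨⟨w, hw⟩, h1, h2⟩ := (LinearPMap.mem_graph_iff _).1 (mem_L0k_graph.1 hv)
    obtain rfl : w = incl k u := h1
    exact ⟨hw, h2 ▸ v.2⟩
  · rintro ⟨h, hm⟩
    exact ⟨⟨L0 ⟨incl k u, h⟩, hm⟩, mem_L0k_graph.2 (L0.mem_graph ⟨incl k u, h⟩)⟩

/-! ### Strongly continuous semigroups -/

/-- `S : [0,∞) → 𝓑(X)` is a strongly continuous one-parameter semigroup. -/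
structure IsC0Semigroup {X : Type*} [NormedAddCommGroup X] [NormedSpace ℂ X]
    (S : ℝ≥0 → X →L[ℂ] X) : Prop where
  map_zero : S 0 = ContinuousLinearMap.id ℂ X
  map_add : ∀ s t, S (s + t) = (S s).comp (S t)
  continuous_orbit : ∀ x, Continuous fun t => S t x

/-- `A` is the generator of `S`: `x ∈ 𝓓(A)` and `A x = y` if and only if
`(S(h) x - x) / h → y` as `h → 0+`. -/
def IsGenerator {X : Type*} [NormedAddCommGroup X] [NormedSpace ℂ X]
    (A : X →ₗ.[ℂ] X) (S : ℝ≥0 → X →L[ℂ] X) : Prop :=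
  ∀ x y : X, (x, y) ∈ A.graph ↔
    Tendsto (fun h : ℝ≥0 => (h : ℝ)⁻¹ • (S h x - x)) (𝓝[>] 0) (𝓝 y)

end SimWave

end

/-! Extend `u₁` to an odd and `u₂` to an even function and let `p` be their sum. Since
multiplication by `ρ` and differentiation swap parities, the two components of `L̃₀` merge into the
single transport operator `p ↦ (1 - ρ) p'`. Writing `p(ρ) = q(1 - ρ)` turns it into `q ↦ -y q'(y)`,
whose flow is the dilation `q(y) ↦ q(e^{-t} y)`. On polynomials the semigroup is therefore explicit,
and the boundary conditions of `𝓗^{2k}` hold automatically by parity (`isLtilde_profile`,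
`isD_profile`).

The growth bound comes from `Re (u|L̃₀u) ≤ ½‖u‖²`: integration by parts leaves a boundary term that
vanishes at `0` because `u₁(0) = 0` and equals `-½|u₁ - u₂|² ≤ 0` at `1`
(`re_inner_le_of_isLtilde`). This also gives closability, the domain being dense. Commuting `2k`
derivatives past `y d/dy` produces only the favourable term `-2k‖D^{2k}u‖²`, so the same bound holds
in `𝓗^{2k}` (`re_inner_profileK_le`).

Generation is a Lumer–Phillips argument (`exists_semigroup_of_euler`). Dilations of polynomials
extend by density to a semigroup. As `y d/dy` multiplies `yⁿ` by `n`, the operator `1 + y d/dy` maps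
polynomials onto polynomials, so `1 - L_{0,k}` has dense range on them. Since `1 > ½` is not an
eigenvalue of `L₀`, the polynomials form a core of the closed operator `L_{0,k}`, which must then be
the generator.

Completeness of `𝓗^{2k}` and density of polynomials both rest on `isD_iff`: membership in `𝓗^{2k}`
with `D^{2k}u = g` means that `u` is a `2k`-fold primitive of `g` up to a finite-dimensional space
of polynomials. -/

noncomputable section

namespace SimWave

/-! ### Quasi-dissipative operators and closability -/

section Abstract

open Polynomial

variable {X : Type*} [NormedAddCommGroup X] [InnerProductSpace ℂ X]

/-- The inequality expressing that `A - c` is dissipative passes to the closure of the graph. -/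
theorem re_inner_le_of_mem_closure {G : Submodule ℂ (X × X)} {c : ℝ}
    (hG : ∀ p ∈ G, RCLike.re (inner ℂ p.1 p.2) ≤ c * ‖p.1‖ ^ 2) {p : X × X}
    (hp : p ∈ G.topologicalClosure) : RCLike.re (inner ℂ p.1 p.2) ≤ c * ‖p.1‖ ^ 2 := by
  have hcl : IsClosed {p : X × X | RCLike.re (inner ℂ p.1 p.2) ≤ c * ‖p.1‖ ^ 2} :=
    isClosed_le (RCLike.continuous_re.comp (continuous_fst.inner continuous_snd))
      (by fun_prop)
  exact closure_minimal (fun q hq => hG q hq) hcl hp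

/-- A densely defined quasi-dissipative operator is closable. -/
theorem isClosable_of_re_inner_le {A : X →ₗ.[ℂ] X} (hd : Dense (A.domain : Set X)) {c : ℝ}
    (hA : ∀ u v : X, (u, v) ∈ A.graph → RCLike.re (inner ℂ u v) ≤ c * ‖u‖ ^ 2) :
    A.IsClosable := by
  refine ⟨A.graph.topologicalClosure.toLinearPMap,
    (Submodule.toLinearPMap_graph_eq _ ?_).symm⟩
  rintro ⟨u, v⟩ hp (rfl : u = 0)
  have hcl := fun p hp => re_inner_le_of_mem_closure (fun p hp => hA p.1 p.2 hp) (p := p) hp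
  have key : ∀ a ∈ A.domain, RCLike.re (inner ℂ a v) ≤ 0 := by
    intro a ha
    have hab := A.graph.le_topologicalClosure (A.mem_graph ⟨a, ha⟩)
    set b := A ⟨a, ha⟩
    -- Apply the inequality to `(0, v) + t (a, b)` in the closure, divide by `t`, and let `t` tend
    -- to `0`; the quadratic term disappears.
    have h1 : ∀ t : ℝ, 0 < t →
        RCLike.re (inner ℂ a v) ≤ t * (c * ‖a‖ ^ 2 - RCLike.re (inner ℂ a b)) := by
      intro t ht
      have h2 := hcl _ (Submodule.add_mem _ hp (Submodule.smul_mem _ (t : ℂ) hab))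
      simp only [Prod.smul_mk, Prod.mk_add_mk, zero_add, inner_add_right, inner_smul_left,
        inner_smul_right, norm_smul, Complex.conj_ofReal, map_add, RCLike.re_to_complex,
        Complex.re_ofReal_mul, Complex.norm_real, Real.norm_eq_abs, mul_pow, sq_abs] at h2
      simp only [RCLike.re_to_complex]
      nlinarith
    have h3 : Tendsto (fun t : ℝ => t * (c * ‖a‖ ^ 2 - RCLike.re (inner ℂ a b))) (𝓝[>] 0)
        (𝓝 0) := by
      refine Tendsto.mono_left ?_ nhdsWithin_le_nhds
      have h := (continuous_mul_const (c * ‖a‖ ^ 2 - RCLike.re (inner ℂ a b))).tendsto (0 : ℝ)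
      rwa [zero_mul] at h
    exact ge_of_tendsto h3 (by filter_upwards [self_mem_nhdsWithin] with t ht using h1 t ht)
  have h4 : ∀ a : X, RCLike.re (inner ℂ a v) ≤ 0 := by
    have hcl : IsClosed {a : X | RCLike.re (inner ℂ a v) ≤ 0} :=
      isClosed_le (RCLike.continuous_re.comp (continuous_id.inner continuous_const))
        continuous_const
    intro a
    exact closure_minimal key hcl (hd a)
  have h5 := h4 v
  rw [inner_self_eq_norm_sq] at h5
  exact norm_eq_zero.1 (by nlinarith [norm_nonneg v])

/-! ### Dilations and the Euler operator on polynomials -/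

/-- The dilation `q ↦ q(e^{-t} X)`. -/
def dilate (t : ℝ) : ℂ[X] →ₗ[ℂ] ℂ[X] :=
  (aeval (C ((Real.exp (-t) : ℝ) : ℂ) * Polynomial.X)).toLinearMap

/-- The Euler operator `q ↦ X q'`. -/
def euler : ℂ[X] →ₗ[ℂ] ℂ[X] := LinearMap.mulLeft ℂ Polynomial.X ∘ₗ derivative

theorem dilate_monomial (t : ℝ) (n : ℕ) (c : ℂ) :
    dilate t (monomial n c) = ((Real.exp (-(n * t)) : ℝ) : ℂ) • monomial n c := by
  have h : Real.exp (-(n * t)) = Real.exp (-t) ^ n := by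
    rw [← Real.exp_nat_mul]; congr 1; ring
  rw [dilate, AlgHom.toLinearMap_apply, aeval_monomial, mul_pow, ← C_mul_X_pow_eq_monomial,
    smul_eq_C_mul, h, Complex.ofReal_pow, C_pow, algebraMap_eq]
  ring

theorem euler_monomial (n : ℕ) (c : ℂ) : euler (monomial n c) = (n : ℂ) • monomial n c := by
  rw [euler, LinearMap.comp_apply, LinearMap.mulLeft_apply, derivative_monomial]
  rcases n with - | n
  · simp
  · rw [X_mul_monomial, smul_monomial, smul_eq_mul, mul_comm, Nat.add_sub_cancel]

theorem dilate_zero : dilate 0 = LinearMap.id := by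
  ext n : 2
  simp [dilate_monomial]

theorem dilate_add (s t : ℝ) (q : ℂ[X]) : dilate (s + t) q = dilate s (dilate t q) := by
  induction q using Polynomial.induction_on' with
  | add p q hp hq => simp only [map_add, hp, hq]
  | monomial n c =>
    rw [dilate_monomial, dilate_monomial, map_smul, dilate_monomial, smul_smul,
      ← Complex.ofReal_mul, ← Real.exp_add]
    congr 3; ring

theorem euler_dilate (t : ℝ) (q : ℂ[X]) : euler (dilate t q) = dilate t (euler q) := by
  induction q using Polynomial.induction_on' with
  | add p q hp hq => simp only [map_add, hp, hq]
  | monomial n c =>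
    rw [dilate_monomial, map_smul, euler_monomial, map_smul, dilate_monomial, smul_comm]

/-- `1 + X d/dX` is onto. -/
theorem exists_add_euler_eq (f : ℂ[X]) : ∃ q : ℂ[X], q + euler q = f := by
  induction f using Polynomial.induction_on' with
  | add p q hp hq =>
    obtain ⟨a, rfl⟩ := hp
    obtain ⟨b, rfl⟩ := hq
    exact ⟨a + b, by rw [map_add]; abel⟩
  | monomial n c =>
    refine ⟨((1 + n : ℂ)⁻¹) • monomial n c, ?_⟩
    have h : (1 + n : ℂ) ≠ 0 := by
      rw [add_comm]; exact Nat.cast_add_one_ne_zero n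
    rw [map_smul, euler_monomial, ← smul_add]
    nth_rw 1 [← one_smul ℂ (monomial n c)]
    rw [← add_smul, smul_smul, inv_mul_cancel₀ h, one_smul]

variable (Ψ : ℂ[X] →ₗ[ℂ] X)

theorem hasDerivAt_dilate (q : ℂ[X]) (t : ℝ) :
    HasDerivAt (fun t => Ψ (dilate t q)) (-Ψ (euler (dilate t q))) t := by
  induction q using Polynomial.induction_on' with
  | add p q hp hq =>
    simp only [map_add, neg_add]
    exact hp.add hq
  | monomial n c =>
    simp only [dilate_monomial, map_smul, euler_monomial, smul_smul]
    have h : HasDerivAt (fun t : ℝ => ((Real.exp (-(n * t)) : ℝ) : ℂ))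
        ((Real.exp (-(n * t)) * (-(n * 1)) : ℝ) : ℂ) t :=
      (((hasDerivAt_id t).const_mul (n : ℝ)).neg.exp).ofReal_comp
    convert! h.smul_const (Ψ (monomial n c)) using 1
    rw [← neg_smul]
    push_cast
    congr 1
    ring

variable {Ψ}

/-- Dissipativity at every point of the orbit makes `e^{-s} ‖Ψ (dilate s q)‖²` nonincreasing in `s`;
compare `s = t` with `s = 0`. -/
theorem norm_dilate_le
    (hdiss : ∀ q, RCLike.re (inner ℂ (Ψ q) (-Ψ (euler q))) ≤ 1 / 2 * ‖Ψ q‖ ^ 2)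
    {t : ℝ} (ht : 0 ≤ t) (q : ℂ[X]) : ‖Ψ (dilate t q)‖ ≤ Real.exp (t / 2) * ‖Ψ q‖ := by
  set F : ℝ → X := fun t => Ψ (dilate t q) with hF
  have hN : ∀ s, HasDerivAt (fun s => ‖F s‖ ^ 2)
      (2 * RCLike.re (inner ℂ (F s) (-Ψ (euler (dilate s q))))) s := by
    intro s
    have h1 := (hasDerivAt_dilate Ψ q s).inner ℂ (hasDerivAt_dilate Ψ q s)
    have h2 := Complex.reCLM.hasFDerivAt.comp_hasDerivAt s h1
    have e : (fun s => ‖F s‖ ^ 2) = Complex.reCLM ∘ fun s => inner ℂ (F s) (F s) := by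
      funext s
      simp only [Function.comp_apply, Complex.reCLM_apply]
      exact (inner_self_eq_norm_sq (𝕜 := ℂ) (F s)).symm
    rw [e]
    convert! h2 using 1
    rw [Complex.reCLM_apply, Complex.add_re, two_mul]
    congr 1
    exact inner_re_symm (𝕜 := ℂ) _ _
  have hG : ∀ s, HasDerivAt (fun s => Real.exp (-s) * ‖F s‖ ^ 2)
      (Real.exp (-s) * -1 * ‖F s‖ ^ 2 + Real.exp (-s) *
        (2 * RCLike.re (inner ℂ (F s) (-Ψ (euler (dilate s q)))))) s := fun s =>
    (hasDerivAt_id s).neg.exp.mul (hN s)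
  have hanti : Antitone (fun s => Real.exp (-s) * ‖F s‖ ^ 2) := by
    refine antitone_of_deriv_nonpos (fun s => (hG s).differentiableAt) fun s => ?_
    rw [(hG s).deriv]
    have := hdiss (dilate s q)
    nlinarith [Real.exp_pos (-s)]
  have h := hanti ht
  have h0 : F 0 = Ψ q := by simp [hF, dilate_zero]
  simp only [neg_zero, Real.exp_zero, one_mul, h0] at h
  refine abs_le_of_sq_le_sq' ?_ (by positivity) |>.2
  rw [mul_pow, ← Real.exp_nat_mul]
  have e : Real.exp ((2 : ℕ) * (t / 2)) * Real.exp (-t) = 1 := by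
    rw [← Real.exp_add]; simp; ring
  calc ‖F t‖ ^ 2 = Real.exp ((2 : ℕ) * (t / 2)) * (Real.exp (-t) * ‖F t‖ ^ 2) := by
        rw [← mul_assoc, e, one_mul]
    _ ≤ _ := by gcongr

/-- By Cauchy–Schwarz, `½‖u‖² ≤ Re (u|u - v) ≤ ‖u‖ ‖u - v‖`. For `v = A u` this bounds `1 - A` from
below, which lets convergence of `u - A u` be transferred to `u`. -/
theorem norm_le_two_mul_norm_sub {u v : X} (h : RCLike.re (inner ℂ u v) ≤ 1 / 2 * ‖u‖ ^ 2) :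
    ‖u‖ ≤ 2 * ‖u - v‖ := by
  have h1 : RCLike.re (inner ℂ u (u - v)) ≤ ‖u‖ * ‖u - v‖ := re_inner_le_norm _ _
  rw [inner_sub_right, map_sub, inner_self_eq_norm_sq] at h1
  by_contra! hlt
  have h0 : 0 < ‖u‖ := lt_of_le_of_lt (by positivity) hlt
  nlinarith

/-! ### The dilation semigroup and its generator -/

/-- The semigroup on `X` which extends the dilations of polynomials. -/
def dilationSemigroup [CompleteSpace X] (Ψ : ℂ[X] →ₗ[ℂ] X) (t : ℝ≥0) : X →L[ℂ] X :=
  (Ψ ∘ₗ dilate t).extendOfNorm Ψ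

section
variable [CompleteSpace X] {Ψ : ℂ[X] →ₗ[ℂ] X} (hΨ : DenseRange Ψ)
  (hdiss : ∀ q, RCLike.re (inner ℂ (Ψ q) (-Ψ (euler q))) ≤ 1 / 2 * ‖Ψ q‖ ^ 2)

include hΨ hdiss

theorem dilationSemigroup_apply (t : ℝ≥0) (q : ℂ[X]) :
    dilationSemigroup Ψ t (Ψ q) = Ψ (dilate t q) :=
  LinearMap.extendOfNorm_eq hΨ ⟨_, norm_dilate_le hdiss t.2⟩ q

theorem norm_dilationSemigroup_le (t : ℝ≥0) :
    ‖dilationSemigroup Ψ t‖ ≤ Real.exp ((t : ℝ) / 2) :=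
  LinearMap.opNorm_extendOfNorm_le hΨ (Real.exp_pos _).le (norm_dilate_le hdiss t.2)

theorem isC0Semigroup_dilationSemigroup : IsC0Semigroup (dilationSemigroup Ψ) where
  map_zero := by
    refine ContinuousLinearMap.ext fun x => ?_
    refine hΨ.induction_on x (isClosed_eq (by fun_prop) (by fun_prop)) fun q => ?_
    simp [dilationSemigroup_apply hΨ hdiss, dilate_zero]
  map_add s t := by
    refine ContinuousLinearMap.ext fun x => ?_
    refine hΨ.induction_on x (isClosed_eq (by fun_prop) (by fun_prop)) fun q => ?_
    simp [dilationSemigroup_apply hΨ hdiss, dilate_add]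
  continuous_orbit x := by
    -- Orbits of polynomials are continuous, and the operator norms are bounded by `M` for times
    -- below `t₀ + 1`, so these orbits approximate that of `x` uniformly near `t₀`.
    refine continuous_of_locally_uniform_approx_of_continuousAt fun t₀ u hu => ?_
    obtain ⟨ε, hε, hεu⟩ := Metric.mem_uniformity_dist.1 hu
    set M := Real.exp (((t₀ : ℝ) + 1) / 2) with hM
    have hMpos : 0 < M := Real.exp_pos _
    obtain ⟨q, hq⟩ := hΨ.exists_dist_lt x (ε := ε / M) (by positivity)
    refine ⟨Iio (t₀ + 1), Iio_mem_nhds (lt_add_one t₀), fun t => dilationSemigroup Ψ t (Ψ q),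
      ?_, fun t ht => hεu ?_⟩
    · simp only [dilationSemigroup_apply hΨ hdiss]
      exact ((hasDerivAt_dilate Ψ q _).continuousAt.comp
        NNReal.continuous_coe.continuousAt)
    · rw [dist_eq_norm, ← map_sub]
      have h1 : ‖dilationSemigroup Ψ t‖ ≤ M := by
        refine (norm_dilationSemigroup_le hΨ hdiss t).trans (Real.exp_le_exp.2 ?_)
        have : (t : ℝ) < t₀ + 1 := by exact_mod_cast ht
        linarith
      rw [dist_eq_norm, lt_div_iff₀ hMpos] at hq
      calc _ ≤ M * ‖x - Ψ q‖ := ContinuousLinearMap.le_of_opNorm_le _ h1 _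
        _ < ε := by rwa [mul_comm]

/-- The polynomials form a core. -/
theorem exists_polynomial_seq {A : X →ₗ.[ℂ] X} (hcl : A.IsClosed)
    (hA : ∀ q, (Ψ q, -Ψ (euler q)) ∈ A.graph)
    (hinj : ∀ u : X, (u, u) ∈ A.graph → u = 0) {x y : X} (hxy : (x, y) ∈ A.graph) :
    ∃ p : ℕ → ℂ[X], Tendsto (fun n => Ψ (p n)) atTop (𝓝 x) ∧
      Tendsto (fun n => -Ψ (euler (p n))) atTop (𝓝 y) := by
  obtain ⟨f, hf, hlim⟩ := mem_closure_iff_seq_limit.1 (hΨ (x - y))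
  choose q hq using hf
  choose p hp using fun n => exists_add_euler_eq (q n)
  have hpq : ∀ n, Ψ (p n) - -Ψ (euler (p n)) = f n := fun n => by
    rw [sub_neg_eq_add, ← map_add, hp, hq]
  have hcauchy : CauchySeq fun n => Ψ (p n) := by
    refine Metric.cauchySeq_iff'.2 fun ε hε => ?_
    obtain ⟨N, hN⟩ := Metric.cauchySeq_iff'.1 hlim.cauchySeq (ε / 2) (by positivity)
    refine ⟨N, fun n hn => ?_⟩
    have h1 := norm_le_two_mul_norm_sub (hdiss (p n - p N))
    have h2 : Ψ (p n - p N) - -Ψ (euler (p n - p N)) = f n - f N := by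
      rw [← hpq, ← hpq, map_sub, map_sub, map_sub]; abel
    rw [h2, map_sub, ← dist_eq_norm, ← dist_eq_norm] at h1
    have := hN n hn
    linarith
  obtain ⟨x', hx'⟩ := cauchySeq_tendsto_of_complete hcauchy
  have hy' : Tendsto (fun n => -Ψ (euler (p n))) atTop (𝓝 (x' - (x - y))) := by
    refine (hx'.sub hlim).congr fun n => ?_
    rw [← hpq]; abel
  -- Subtracting this pair from `(x, y)` gives `(x - x', x - x')`, so the absence of the eigenvalue
  -- `1` identifies the limit `x'` with `x`.
  have hmem : (x', x' - (x - y)) ∈ A.graph :=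
    hcl.mem_of_tendsto (hx'.prodMk_nhds hy') (Eventually.of_forall fun n => hA (p n))
  have hx : x - x' = 0 := hinj _ (by
    have h := A.graph.sub_mem hxy hmem
    rw [Prod.mk_sub_mk] at h
    convert h using 2
    abel)
  rw [sub_eq_zero] at hx
  subst hx
  exact ⟨p, hx', by simpa using hy'⟩

/-- Mean value inequality for `s ↦ T(s) q - s y`, whose derivative splits as `T(s)(-Eq - y) + (T(s)
y - y)`, with `E` the Euler operator. The bound sees `q` only through `‖-Eq - y‖`, so it survives
the limit along a sequence from the core. -/
theorem dilate_sub_le (q : ℂ[X]) (y : X) {ε h : ℝ} (hh : 0 ≤ h)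
    (hy : ∀ s : ℝ≥0, (s : ℝ) ≤ h → ‖dilationSemigroup Ψ s y - y‖ ≤ ε) :
    ‖Ψ (dilate h q) - Ψ q - (h : ℂ) • y‖ ≤ (Real.exp (h / 2) * ‖-Ψ (euler q) - y‖ + ε) * h := by
  have hd : ∀ s : ℝ, HasDerivAt (fun s : ℝ => Ψ (dilate s q) - (s : ℂ) • y)
      (-Ψ (euler (dilate s q)) - y) s := fun s => by
    have h1 : HasDerivAt (fun s : ℝ => (s : ℂ) • y) y s := by
      have := ((hasDerivAt_id s).ofReal_comp).smul_const y
      simpa using this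
    exact (hasDerivAt_dilate Ψ q s).sub h1
  have := norm_image_sub_le_of_norm_deriv_le_segment' (a := 0) (b := h)
    (C := Real.exp (h / 2) * ‖-Ψ (euler q) - y‖ + ε)
    (fun s _ => (hd s).hasDerivWithinAt) (fun s hs => ?_) h ⟨hh, le_rfl⟩
  · simp only [dilate_zero, LinearMap.id_apply, Complex.ofReal_zero, zero_smul, sub_zero] at this
    convert this using 2
    abel
  · obtain ⟨hs0, hs1⟩ := hs
    lift s to ℝ≥0 using hs0
    have e : -Ψ (euler (dilate s q)) - y = dilationSemigroup Ψ s (-Ψ (euler q) - y) +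
        (dilationSemigroup Ψ s y - y) := by
      rw [map_sub, map_neg, dilationSemigroup_apply hΨ hdiss, euler_dilate]
      abel
    rw [e]
    refine (norm_add_le _ _).trans (add_le_add ?_ (hy _ hs1.le))
    refine ContinuousLinearMap.le_of_opNorm_le _ ?_ _
    refine (norm_dilationSemigroup_le hΨ hdiss _).trans (Real.exp_le_exp.2 ?_)
    linarith

theorem tendsto_of_mem_graph {A : X →ₗ.[ℂ] X} (hcl : A.IsClosed)
    (hA : ∀ q, (Ψ q, -Ψ (euler q)) ∈ A.graph)
    (hinj : ∀ u : X, (u, u) ∈ A.graph → u = 0) {x y : X} (hxy : (x, y) ∈ A.graph) :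
    Tendsto (fun h : ℝ≥0 => (h : ℝ)⁻¹ • (dilationSemigroup Ψ h x - x)) (𝓝[>] 0) (𝓝 y) := by
  obtain ⟨p, hp1, hp2⟩ := exists_polynomial_seq hΨ hdiss hcl hA hinj hxy
  have hC := isC0Semigroup_dilationSemigroup hΨ hdiss
  refine Metric.tendsto_nhds.2 fun ε hε => ?_
  have h0 : Tendsto (fun t => dilationSemigroup Ψ t y) (𝓝 0) (𝓝 y) := by
    have := (hC.continuous_orbit y).tendsto 0
    rwa [hC.map_zero] at this
  obtain ⟨δ, hδ, hδ'⟩ := Metric.eventually_nhds_iff.1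
    (Metric.tendsto_nhds.1 h0 (ε / 2) (by positivity))
  filter_upwards [mem_nhdsWithin_of_mem_nhds (Metric.ball_mem_nhds (0 : ℝ≥0) hδ),
    self_mem_nhdsWithin] with h hh hpos
  have hpos' : (0 : ℝ) < h := hpos
  have key : ‖dilationSemigroup Ψ h x - x - ((h : ℝ) : ℂ) • y‖ ≤ ε / 2 * h := by
    have hn : ∀ n, ‖dilationSemigroup Ψ h (Ψ (p n)) - Ψ (p n) - ((h : ℝ) : ℂ) • y‖ ≤
        (Real.exp ((h : ℝ) / 2) * ‖-Ψ (euler (p n)) - y‖ + ε / 2) * h := fun n => by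
      rw [dilationSemigroup_apply hΨ hdiss]
      refine dilate_sub_le hΨ hdiss (p n) y h.2 fun s hs => ?_
      rw [← dist_eq_norm]
      refine (hδ' (lt_of_le_of_lt ?_ hh)).le
      rw [NNReal.dist_eq, NNReal.dist_eq]
      simpa using hs
    have l1 := (((((dilationSemigroup Ψ h).continuous.tendsto x).comp hp1).sub hp1).sub
      (tendsto_const_nhds (x := ((h : ℝ) : ℂ) • y))).norm
    have l2 : Tendsto (fun n => (Real.exp ((h : ℝ) / 2) * ‖-Ψ (euler (p n)) - y‖ + ε / 2) * h)
        atTop (𝓝 ((Real.exp ((h : ℝ) / 2) * ‖y - y‖ + ε / 2) * h)) :=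
      (((hp2.sub tendsto_const_nhds).norm.const_mul _).add tendsto_const_nhds).mul_const _
    rw [sub_self, norm_zero, mul_zero, zero_add] at l2
    exact le_of_tendsto_of_tendsto' l1 l2 hn
  rw [dist_eq_norm]
  have e : (h : ℝ)⁻¹ • (dilationSemigroup Ψ h x - x) - y =
      (h : ℝ)⁻¹ • (dilationSemigroup Ψ h x - x - ((h : ℝ) : ℂ) • y) := by
    rw [smul_sub _ _ (((h : ℝ) : ℂ) • y), Complex.coe_smul, inv_smul_smul₀ hpos'.ne']
  rw [e, norm_smul, norm_inv, Real.norm_of_nonneg hpos'.le, inv_mul_lt_iff₀ hpos']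
  nlinarith

end

/-- Cauchy–Schwarz gives `Re (x|S(h)x - x) ≤ (e^{h/2} - 1)‖x‖²`; divide by `h` and let `h → 0+`.
Thus the generator inherits the dissipativity estimate on its whole domain. -/
theorem re_inner_le_of_tendsto {S : ℝ≥0 → X →L[ℂ] X}
    (hS : ∀ t : ℝ≥0, ‖S t‖ ≤ Real.exp ((t : ℝ) / 2)) {x y : X}
    (hxy : Tendsto (fun h : ℝ≥0 => (h : ℝ)⁻¹ • (S h x - x)) (𝓝[>] 0) (𝓝 y)) :
    RCLike.re (inner ℂ x y) ≤ 1 / 2 * ‖x‖ ^ 2 := by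
  have h1 : Tendsto (fun h : ℝ≥0 => RCLike.re (inner ℂ x ((h : ℝ)⁻¹ • (S h x - x))))
      (𝓝[>] 0) (𝓝 (RCLike.re (inner ℂ x y))) :=
    (RCLike.continuous_re.tendsto _).comp (tendsto_const_nhds.inner hxy)
  have hd : HasDerivAt (fun t : ℝ => Real.exp (t / 2)) (1 / 2) 0 := by
    simpa using ((hasDerivAt_id (0 : ℝ)).div_const 2).exp
  have h2 : Tendsto (fun h : ℝ≥0 => (h : ℝ)⁻¹ * (Real.exp ((h : ℝ) / 2) - 1) * ‖x‖ ^ 2)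
      (𝓝[>] 0) (𝓝 (1 / 2 * ‖x‖ ^ 2)) := by
    refine Tendsto.mul_const _ ?_
    have h3 := hd.tendsto_slope_zero_right
    simp only [zero_add, zero_div, Real.exp_zero, smul_eq_mul] at h3
    refine h3.comp (tendsto_nhdsWithin_iff.2 ⟨?_, ?_⟩)
    · exact (NNReal.continuous_coe.tendsto' 0 0 rfl).mono_left nhdsWithin_le_nhds
    · filter_upwards [self_mem_nhdsWithin] with h hh using hh
  refine le_of_tendsto_of_tendsto h1 h2 ?_
  filter_upwards [self_mem_nhdsWithin] with h hh
  have hpos : (0 : ℝ) < h := hh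
  have h4 : RCLike.re (inner ℂ x (S h x)) ≤ Real.exp ((h : ℝ) / 2) * ‖x‖ ^ 2 := by
    refine (re_inner_le_norm x (S h x)).trans ?_
    have := ContinuousLinearMap.le_of_opNorm_le _ (hS h) x
    nlinarith [norm_nonneg x]
  rw [← Complex.coe_smul, inner_smul_right, inner_sub_right, RCLike.re_to_complex,
    Complex.re_ofReal_mul, Complex.sub_re, mul_assoc]
  have h5 := inner_self_eq_norm_sq (𝕜 := ℂ) x
  rw [RCLike.re_to_complex] at h4 h5
  gcongr
  linarith

/-- A closed operator which acts on a dense space of polynomials as `-X d/dX`, which is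
quasi-dissipative there and does not have the eigenvalue `1`, generates a semigroup. -/
theorem exists_semigroup_of_euler [CompleteSpace X] {Ψ : ℂ[X] →ₗ[ℂ] X} (hΨ : DenseRange Ψ)
    (hdiss : ∀ q, RCLike.re (inner ℂ (Ψ q) (-Ψ (euler q))) ≤ 1 / 2 * ‖Ψ q‖ ^ 2)
    {A : X →ₗ.[ℂ] X} (hcl : A.IsClosed) (hA : ∀ q, (Ψ q, -Ψ (euler q)) ∈ A.graph)
    (hinj : ∀ u : X, (u, u) ∈ A.graph → u = 0) :
    ∃ S : ℝ≥0 → X →L[ℂ] X, IsC0Semigroup S ∧ IsGenerator A S ∧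
      ∀ τ : ℝ≥0, ‖S τ‖ ≤ Real.exp ((τ : ℝ) / 2) := by
  have hS := norm_dilationSemigroup_le hΨ hdiss
  have hAS := fun x y => tendsto_of_mem_graph hΨ hdiss hcl hA hinj (x := x) (y := y)
  refine ⟨dilationSemigroup Ψ, isC0Semigroup_dilationSemigroup hΨ hdiss,
    fun x y => ⟨hAS x y, fun hxy => ?_⟩, hS⟩
  obtain ⟨f, hf, hlim⟩ := mem_closure_iff_seq_limit.1 (hΨ (x - y))
  choose q hq using hf
  choose p hp using fun n => exists_add_euler_eq (q n)
  have hpq : ∀ n, Ψ (p n) - -Ψ (euler (p n)) = f n := fun n => by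
    rw [sub_neg_eq_add, ← map_add, hp, hq]
  -- The generator extends `A`, so its lower bound applies to `x - Ψ (p n)`. Hence `Ψ (p n) → x`,
  -- and closedness of `A` puts `(x, y)` into its graph.
  have hle : ∀ n, ‖x - Ψ (p n)‖ ≤ 2 * ‖x - y - f n‖ := fun n => by
    have h1 := hxy.sub (hAS _ _ (hA (p n)))
    have h2 : Tendsto (fun h : ℝ≥0 => (h : ℝ)⁻¹ •
        (dilationSemigroup Ψ h (x - Ψ (p n)) - (x - Ψ (p n)))) (𝓝[>] 0)
        (𝓝 (y - -Ψ (euler (p n)))) := by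
      refine h1.congr fun h => ?_
      rw [← smul_sub, map_sub]
      congr 1
      abel
    convert norm_le_two_mul_norm_sub (re_inner_le_of_tendsto hS h2) using 3
    rw [← hpq]
    abel
  have hx : Tendsto (fun n => Ψ (p n)) atTop (𝓝 x) := by
    rw [tendsto_iff_norm_sub_tendsto_zero]
    have h1 : Tendsto (fun n => 2 * ‖x - y - f n‖) atTop (𝓝 0) := by
      have := ((tendsto_const_nhds (x := x - y)).sub hlim).norm.const_mul 2
      simpa using this
    refine squeeze_zero (fun n => norm_nonneg _) (fun n => ?_) h1
    rw [norm_sub_rev]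
    exact hle n
  have hy : Tendsto (fun n => -Ψ (euler (p n))) atTop (𝓝 y) := by
    have h1 := hx.sub hlim
    rw [sub_sub_cancel] at h1
    refine h1.congr fun n => ?_
    rw [← hpq]
    abel
  exact hcl.mem_of_tendsto (hx.prodMk_nhds hy) (Eventually.of_forall fun n => hA (p n))

end Abstract

/-! ### Polynomials and the Volterra operator in `L²(0,1)` -/

section Sobolev

open Polynomial

theorem integral_mu_eq_interval (f : ℝ → ℂ) : ∫ x, f x ∂mu = ∫ x in (0 : ℝ)..1, f x := by
  rw [intervalIntegral.integral_of_le zero_le_one, integral_Ioc_eq_integral_Ioo]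

theorem integrable_coeFn (f : L2) : Integrable (f : ℝ → ℂ) mu :=
  (Lp.memLp f).integrable (by norm_num)

theorem continuous_eval_ofReal (p : ℂ[X]) : Continuous fun x : ℝ => p.eval (x : ℂ) :=
  p.continuous.comp Complex.continuous_ofReal

theorem hasDerivAt_eval_ofReal (p : ℂ[X]) (x : ℝ) :
    HasDerivAt (fun x : ℝ => p.eval (x : ℂ)) (p.derivative.eval (x : ℂ)) x :=
  (p.hasDerivAt (x : ℂ)).comp_ofReal

/-- The class of a polynomial in `L²(0,1)`. -/
def pol : ℂ[X] →ₗ[ℂ] L2 where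
  toFun p := (memLp_of_continuousOn (continuous_eval_ofReal p).continuousOn).toLp
  map_add' p q := by
    rw [← MemLp.toLp_add]
    congr 1
    funext x
    simp
  map_smul' c p := by
    rw [RingHom.id_apply, ← MemLp.toLp_const_smul]
    congr 1
    funext x
    simp

theorem coeFn_pol (p : ℂ[X]) : pol p =ᵐ[mu] fun x => p.eval (x : ℂ) :=
  (memLp_of_continuousOn (continuous_eval_ofReal p).continuousOn).coeFn_toLp

theorem integrableOn_coeFn_Icc (f : L2) : IntegrableOn (f : ℝ → ℂ) (uIcc 0 1) volume := by
  rw [uIcc_of_le zero_le_one, integrableOn_Icc_iff_integrableOn_Ioo]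
  exact integrable_coeFn f

theorem continuousOn_primitive (f : L2) :
    ContinuousOn (fun x => ∫ t in (0 : ℝ)..x, f t) (Icc 0 1) := by
  have := intervalIntegral.continuousOn_primitive_interval (integrableOn_coeFn_Icc f)
  rwa [uIcc_of_le zero_le_one] at this

theorem primitive_congr {f g : ℝ → ℂ} (h : f =ᵐ[mu] g) {x : ℝ} (hx : x ∈ Ioo (0 : ℝ) 1) :
    ∫ t in (0 : ℝ)..x, f t = ∫ t in (0 : ℝ)..x, g t := by
  rw [intervalIntegral.integral_of_le hx.1.le, intervalIntegral.integral_of_le hx.1.le]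
  refine integral_congr_ae (ae_mono (Measure.restrict_mono_set _ ?_) h)
  exact fun t ht => ⟨ht.1, ht.2.trans_lt hx.2⟩

theorem intervalIntegrable_coeFn (f : L2) {x : ℝ} (hx : x ∈ Ioo (0 : ℝ) 1) :
    IntervalIntegrable (f : ℝ → ℂ) volume 0 x := by
  rw [intervalIntegrable_iff_integrableOn_Ioo_of_le hx.1.le]
  exact IntegrableOn.mono_set (integrable_coeFn f) (Ioo_subset_Ioo_right hx.2.le)

theorem norm_primitive_le (f : L2) {x : ℝ} (hx : x ∈ Ioo (0 : ℝ) 1) :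
    ‖∫ t in (0 : ℝ)..x, f t‖ ≤ ‖f‖ := by
  have h1 : ‖∫ t in (0 : ℝ)..x, f t‖ ≤ ∫ t, ‖f t‖ ∂mu := by
    rw [intervalIntegral.integral_of_le hx.1.le, integral_Ioc_eq_integral_Ioo]
    refine (norm_integral_le_integral_norm _).trans ?_
    exact setIntegral_mono_set (integrable_coeFn f).norm
      (Eventually.of_forall fun _ => norm_nonneg _)
      (Ioo_subset_Ioo_right hx.2.le).eventuallyLE
  refine h1.trans ?_
  have : IsProbabilityMeasure mu := ⟨by simp⟩
  have h2 : eLpNorm (f : ℝ → ℂ) 1 mu ≤ eLpNorm (f : ℝ → ℂ) 2 mu :=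
    eLpNorm_le_eLpNorm_of_exponent_le (by norm_num) (Lp.memLp f).1
  rw [Lp.norm_def, integral_norm_eq_lintegral_enorm (Lp.memLp f).1, ← eLpNorm_one_eq_lintegral_enorm]
  exact ENNReal.toReal_mono (Lp.memLp f).2.ne h2

/-- The Volterra operator `f ↦ ∫₀ˣ f`. -/
def volterraₗ : L2 →ₗ[ℂ] L2 where
  toFun f := (memLp_of_continuousOn (continuousOn_primitive f)).toLp
  map_add' f g := by
    rw [← MemLp.toLp_add, MemLp.toLp_eq_toLp_iff]
    filter_upwards [ae_restrict_mem measurableSet_Ioo] with x hx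
    rw [Pi.add_apply, primitive_congr (Lp.coeFn_add f g) hx]
    exact intervalIntegral.integral_add (intervalIntegrable_coeFn f hx)
      (intervalIntegrable_coeFn g hx)
  map_smul' c f := by
    rw [RingHom.id_apply, ← MemLp.toLp_const_smul, MemLp.toLp_eq_toLp_iff]
    filter_upwards [ae_restrict_mem measurableSet_Ioo] with x hx
    rw [Pi.smul_apply, primitive_congr (Lp.coeFn_smul c f) hx]
    exact intervalIntegral.integral_smul c (f : ℝ → ℂ)

theorem coeFn_volterraₗ (f : L2) : volterraₗ f =ᵐ[mu] fun x => ∫ t in (0 : ℝ)..x, f t :=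
  (memLp_of_continuousOn (continuousOn_primitive f)).coeFn_toLp

/-- The Volterra operator as a bounded operator. -/
def volterra : L2 →L[ℂ] L2 := volterraₗ.mkContinuous 1 fun f => by
  have h := Lp.norm_le_of_ae_bound (f := volterraₗ f) (norm_nonneg f) (by
    filter_upwards [coeFn_volterraₗ f, ae_restrict_mem measurableSet_Ioo] with x hx hm
    rw [hx]
    exact norm_primitive_le f hm)
  simpa [measureUnivNNReal] using h

theorem coeFn_volterra (f : L2) : volterra f =ᵐ[mu] fun x => ∫ t in (0 : ℝ)..x, f t :=
  coeFn_volterraₗ f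

theorem volterra_pol_derivative (p : ℂ[X]) :
    volterra (pol (derivative p)) = pol p - p.eval 0 • pol 1 := by
  refine Lp.ext ?_
  filter_upwards [coeFn_volterra (pol (derivative p)), Lp.coeFn_sub (pol p) (p.eval 0 • pol 1),
    Lp.coeFn_smul (p.eval 0) (pol 1), coeFn_pol p, coeFn_pol 1,
    ae_restrict_mem measurableSet_Ioo] with x h1 h2 h3 h4 h5 hx
  rw [h1, h2, Pi.sub_apply, h3, Pi.smul_apply, h4, h5, primitive_congr (coeFn_pol _) hx,
    intervalIntegral.integral_eq_sub_of_hasDerivAt (fun t _ => hasDerivAt_eval_ofReal p t)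
      ((continuous_eval_ofReal _).intervalIntegrable _ _)]
  simp

/-- The functional is the inner product with the class of `ψ`. -/
theorem continuous_integral_smul {ψ : ℝ → ℝ} (hψ : Continuous ψ) :
    Continuous fun f : L2 => ∫ x in Ioo (0 : ℝ) 1, ψ x • f x := by
  have hm := memLp_of_continuousOn (Complex.continuous_ofReal.comp hψ).continuousOn
  have h : (fun f : L2 => ∫ x in Ioo (0 : ℝ) 1, ψ x • f x) = fun f => inner ℂ hm.toLp f := by
    funext f
    rw [L2.inner_def]
    refine integral_congr_ae ?_
    filter_upwards [hm.coeFn_toLp] with x hx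
    rw [hx, RCLike.inner_apply']
    simp
  rw [h]
  fun_prop

theorem isClosed_isWeakDeriv (j : ℕ) : IsClosed {p : L2 × L2 | IsWeakDeriv j p.1 p.2} := by
  simp only [IsWeakDeriv, ofPred_forall]
  refine isClosed_iInter fun φ => isClosed_iInter fun hφ => isClosed_iInter fun _ =>
    isClosed_iInter fun _ => isClosed_eq ?_ ?_
  · exact (continuous_integral_smul (hφ.continuous_iteratedDeriv j (by exact_mod_cast le_top))).comp
      continuous_fst
  · exact ((continuous_integral_smul hφ.continuous).comp continuous_snd).const_mul _

/-! ### Density of even, odd and all polynomials -/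

/-- An integrable function on `(0,1)` whose even moments vanish is zero. -/
theorem ae_eq_zero_of_even_moments {f : ℝ → ℂ} (hf : Integrable f mu)
    (h : ∀ n : ℕ, ∫ x in Ioo (0 : ℝ) 1, (x ^ (2 * n) : ℝ) • f x = 0) : f =ᵐ[mu] 0 := by
  have hint : ∀ ψ : ℝ → ℝ, Continuous ψ → Integrable (fun x => ψ x • f x) mu := by
    intro ψ hψ
    obtain ⟨C, hC⟩ := isCompact_Icc.exists_bound_of_continuousOn (s := Icc (0 : ℝ) 1)
      hψ.continuousOn
    refine hf.bdd_smul C hψ.aestronglyMeasurable ?_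
    filter_upwards [ae_restrict_mem measurableSet_Ioo] with x hx
    exact hC x (Ioo_subset_Icc_self hx)
  have hpol : ∀ p : ℝ[X], ∫ x in Ioo (0 : ℝ) 1, p.eval (x ^ 2) • f x = 0 := by
    intro p
    induction p using Polynomial.induction_on' with
    | add p q hp hq =>
      simp only [eval_add, add_smul]
      rw [integral_add (hint (fun x => p.eval (x ^ 2)) (by fun_prop))
        (hint (fun x => q.eval (x ^ 2)) (by fun_prop)), hp, hq, add_zero]
    | monomial n c =>
      simp only [eval_monomial, mul_smul, ← pow_mul]
      rw [integral_smul, h, smul_zero]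
  have key : ∀ᵐ x ∂(volume : Measure ℝ), x ∈ Ioo (0 : ℝ) 1 → f x = 0 := by
    refine isOpen_Ioo.ae_eq_zero_of_integral_contDiff_smul_eq_zero
      (IntegrableOn.locallyIntegrableOn hf) ?_
    intro φ hφ hc hs
    have e : ∫ x, φ x • f x = ∫ x in Ioo (0 : ℝ) 1, φ x • f x := by
      refine (setIntegral_eq_integral_of_forall_compl_eq_zero fun x hx => ?_).symm
      rw [image_eq_zero_of_notMem_tsupport fun hx' => hx (hs hx'), zero_smul]
    rw [e, ← norm_le_zero_iff]
    have hb : ∀ ε > 0, ‖∫ x in Ioo (0 : ℝ) 1, φ x • f x‖ ≤ ε * ∫ x, ‖f x‖ ∂mu := by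
      intro ε hε
      -- Weierstrass in the variable `y = x²` approximates `φ` on `(0,1)` by even polynomials.
      obtain ⟨p, hp⟩ := exists_polynomial_near_of_continuousOn 0 1 (fun y => φ (√y))
        (hφ.continuous.comp Real.continuous_sqrt).continuousOn ε hε
      have e2 : ∫ x in Ioo (0 : ℝ) 1, φ x • f x =
          ∫ x in Ioo (0 : ℝ) 1, (φ x - p.eval (x ^ 2)) • f x := by
        simp only [sub_smul]
        rw [integral_sub (hint φ hφ.continuous) (hint (fun x => p.eval (x ^ 2)) (by fun_prop)),
          hpol, sub_zero]
      rw [e2, ← integral_const_mul]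
      refine norm_integral_le_of_norm_le (hf.norm.const_mul ε) ?_
      filter_upwards [ae_restrict_mem measurableSet_Ioo] with x hx
      rw [norm_smul]
      gcongr
      have := hp (x ^ 2) ⟨by positivity, by nlinarith [hx.1, hx.2]⟩
      rw [Real.sqrt_sq hx.1.le, abs_sub_comm] at this
      exact this.le
    have hlim : Tendsto (fun ε : ℝ => ε * ∫ x, ‖f x‖ ∂mu) (𝓝[>] 0) (𝓝 0) := by
      have := ((continuous_mul_const (∫ x, ‖f x‖ ∂mu)).tendsto (0 : ℝ)).mono_left
        (nhdsWithin_le_nhds (s := Ioi 0))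
      rwa [zero_mul] at this
    exact ge_of_tendsto hlim (by filter_upwards [self_mem_nhdsWithin] with ε hε using hb ε hε)
  exact (ae_restrict_iff' measurableSet_Ioo).2 key

theorem inner_pol_X_pow (n : ℕ) (f : L2) :
    inner ℂ (pol (Polynomial.X ^ n)) f = ∫ x in Ioo (0 : ℝ) 1, (x ^ n : ℝ) • f x := by
  rw [L2.inner_def]
  refine integral_congr_ae ?_
  filter_upwards [coeFn_pol (Polynomial.X ^ n)] with x hx
  rw [hx, RCLike.inner_apply']
  simp

theorem eq_zero_of_inner_even {f : L2} (h : ∀ n, inner ℂ (pol (Polynomial.X ^ (2 * n))) f = 0) :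
    f = 0 := by
  rw [Lp.eq_zero_iff_ae_eq_zero]
  exact ae_eq_zero_of_even_moments (integrable_coeFn f) fun n => by rw [← inner_pol_X_pow, h]

theorem eq_zero_of_inner_odd {f : L2}
    (h : ∀ n, inner ℂ (pol (Polynomial.X ^ (2 * n + 1))) f = 0) : f = 0 := by
  rw [Lp.eq_zero_iff_ae_eq_zero]
  have hint : Integrable (fun x : ℝ => x • f x) mu := by
    refine (integrable_coeFn f).bdd_smul 1 continuous_id.aestronglyMeasurable ?_
    filter_upwards [ae_restrict_mem measurableSet_Ioo] with x hx
    rw [id, Real.norm_of_nonneg hx.1.le]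
    exact hx.2.le
  -- The odd moments of `f` are the even moments of `x f(x)`.
  have := ae_eq_zero_of_even_moments hint fun n => by
    rw [← h n, inner_pol_X_pow]
    simp only [smul_smul, pow_succ]
  filter_upwards [this, ae_restrict_mem measurableSet_Ioo] with x h1 hx
  exact (smul_eq_zero.1 h1).resolve_left hx.1.ne'

theorem denseRange_pol : DenseRange pol := by
  have h : (LinearMap.range pol).topologicalClosure = ⊤ := by
    rw [Submodule.topologicalClosure_eq_top_iff, Submodule.eq_bot_iff]
    intro f hf
    exact eq_zero_of_inner_even fun n => hf _ ⟨_, rfl⟩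
  have := (Submodule.dense_iff_topologicalClosure_eq_top).2 h
  rwa [LinearMap.coe_range] at this

/-! ### Weak derivatives and traces through primitives -/

theorem isWeakDeriv_pol (p : ℂ[X]) : IsWeakDeriv 1 (pol p) (pol (derivative p)) := by
  intro φ hφ hc hs
  have e1 : ∫ x in Ioo (0 : ℝ) 1, iteratedDeriv 1 φ x • pol p x =
      ∫ x in (0 : ℝ)..1, ((deriv φ x : ℝ) : ℂ) * p.eval (x : ℂ) := by
    rw [← integral_mu_eq_interval]
    refine integral_congr_ae ?_
    filter_upwards [coeFn_pol p] with x hx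
    rw [hx, iteratedDeriv_one, Complex.real_smul]
  have e2 : ∫ x in Ioo (0 : ℝ) 1, φ x • pol (derivative p) x =
      ∫ x in (0 : ℝ)..1, ((φ x : ℝ) : ℂ) * (derivative p).eval (x : ℂ) := by
    rw [← integral_mu_eq_interval]
    refine integral_congr_ae ?_
    filter_upwards [coeFn_pol (derivative p)] with x hx
    rw [hx, Complex.real_smul]
  have h0 : φ 0 = 0 := image_eq_zero_of_notMem_tsupport fun h => lt_irrefl _ (hs h).1
  have h1 : φ 1 = 0 := image_eq_zero_of_notMem_tsupport fun h => lt_irrefl _ (hs h).2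
  rw [e1, e2, intervalIntegral.integral_mul_deriv_eq_deriv_mul
    (u := fun x => ((φ x : ℝ) : ℂ)) (u' := fun x => ((deriv φ x : ℝ) : ℂ))
    (v := fun x : ℝ => p.eval (x : ℂ))
    (fun x _ => ((hφ.differentiable (by simp)) x).hasDerivAt.ofReal_comp)
    (fun x _ => hasDerivAt_eval_ofReal p x)
    ((Complex.continuous_ofReal.comp (hφ.continuous_deriv (by simp))).intervalIntegrable _ _)
    ((continuous_eval_ofReal _).intervalIntegrable _ _), h0, h1]
  simp

theorem exists_derivative_eq (p : ℂ[X]) : ∃ q : ℂ[X], derivative q = p := by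
  induction p using Polynomial.induction_on' with
  | add p q hp hq =>
    obtain ⟨a, rfl⟩ := hp
    obtain ⟨b, rfl⟩ := hq
    exact ⟨a + b, map_add _ _ _⟩
  | monomial n c =>
    refine ⟨monomial (n + 1) (c / (n + 1)), ?_⟩
    rw [derivative_monomial]
    push_cast
    rw [div_mul_cancel₀ _ (Nat.cast_add_one_ne_zero n)]

/-- The relation is closed in `f` because `volterra` is bounded, so it need only be checked on
polynomials, where a primitive is a polynomial too. -/
theorem isWeakDeriv_volterra (f : L2) : IsWeakDeriv 1 (volterra f) f := by
  have hcl : IsClosed {f : L2 | IsWeakDeriv 1 (volterra f) f} :=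
    (isClosed_isWeakDeriv 1).preimage (volterra.continuous.prodMk continuous_id)
  refine denseRange_pol.induction_on f hcl fun p => ?_
  obtain ⟨q, rfl⟩ := exists_derivative_eq p
  rw [volterra_pol_derivative, sub_eq_add_neg, ← neg_smul]
  have := (isWeakDeriv_pol q).add ((isWeakDeriv_pol 1).smul (-q.eval 0))
  rwa [derivative_one, map_zero, smul_zero, add_zero] at this

theorem pol_one_eq (c : ℂ) : (c • pol 1 : L2) =ᵐ[mu] fun _ => c := by
  filter_upwards [Lp.coeFn_smul c (pol 1), coeFn_pol 1] with x h1 h2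
  rw [h1, Pi.smul_apply, h2]
  simp

/-- A smooth function with compact support in `(0,1)` and vanishing integral is the derivative of
a function of that type. -/
theorem exists_test_primitive {η : ℝ → ℝ} (hη : ContDiff ℝ ∞ η) {K : Set ℝ} (hK : IsCompact K)
    (hne : K.Nonempty) (hK1 : K ⊆ Ioo 0 1) (hsupp : Function.support η ⊆ K) (hint : ∫ x, η x = 0) :
    ∃ φ : ℝ → ℝ, ContDiff ℝ ∞ φ ∧ HasCompactSupport φ ∧ tsupport φ ⊆ Ioo 0 1 ∧ deriv φ = η := by
  obtain ⟨a, ha, ha'⟩ := hK.exists_isLeast hne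
  obtain ⟨b, hb, hb'⟩ := hK.exists_isGreatest hne
  have hd : ∀ x, HasDerivAt (fun x => ∫ t in (0 : ℝ)..x, η t) (η x) x := fun x =>
    intervalIntegral.integral_hasDerivAt_right (hη.continuous.intervalIntegrable _ _)
      (hη.continuous.stronglyMeasurableAtFilter _ _) hη.continuous.continuousAt
  have hderiv : deriv (fun x => ∫ t in (0 : ℝ)..x, η t) = η := funext fun x => (hd x).deriv
  have hs : Function.support (fun x => ∫ t in (0 : ℝ)..x, η t) ⊆ Icc a b := by
    intro x hx
    by_contra hxab
    refine hx ?_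
    rw [mem_Icc, not_and_or, not_le, not_le] at hxab
    rcases hxab with hxa | hxb
    -- To the left of `a` the integration avoids the support; to the right of `b` it captures all of
    -- it and gives the vanishing total integral.
    · refine intervalIntegral.integral_zero_ae (Eventually.of_forall fun t ht => ?_)
      by_contra hne'
      have h1 := ha' (hsupp hne')
      have h2 := (hK1 ha).1
      rw [mem_uIoc] at ht
      rcases ht with ht | ht <;> linarith [ht.1, ht.2]
    · change ∫ t in (0 : ℝ)..x, η t = 0
      rw [intervalIntegral.integral_eq_integral_of_support_subset, hint]
      intro t ht
      exact ⟨(hK1 (hsupp ht)).1, (hb' (hsupp ht)).trans hxb.le⟩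
  have hts : tsupport (fun x => ∫ t in (0 : ℝ)..x, η t) ⊆ Icc a b :=
    closure_minimal hs isClosed_Icc
  refine ⟨fun x => ∫ t in (0 : ℝ)..x, η t, ?_, ?_, ?_, hderiv⟩
  · rw [contDiff_infty_iff_deriv, hderiv]
    exact ⟨fun x => (hd x).differentiableAt, hη⟩
  · exact HasCompactSupport.of_support_subset_isCompact isCompact_Icc hs
  · exact hts.trans fun x hx => ⟨(hK1 ha).1.trans_le hx.1, hx.2.trans_lt (hK1 hb).2⟩

/-- A function with vanishing weak derivative is constant. -/
theorem IsWeakDeriv.exists_eq_const {f : L2} (h : IsWeakDeriv 1 f 0) : ∃ c : ℂ, f = c • pol 1 := by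
  let B : ContDiffBump (1 / 2 : ℝ) := ⟨1 / 8, 1 / 4, by norm_num, by norm_num⟩
  let φ₀ : ℝ → ℝ := B.normed volume
  have hφ₀ : ContDiff ℝ ∞ φ₀ := B.contDiff_normed
  have hc₀ : HasCompactSupport φ₀ := B.hasCompactSupport_normed
  have hs₀ : tsupport φ₀ ⊆ Ioo 0 1 := by
    rw [B.tsupport_normed_eq, Real.closedBall_eq_Icc]
    intro x hx
    have h1 : B.rOut = 1 / 4 := rfl
    rw [h1] at hx
    constructor <;> linarith [hx.1, hx.2]
  have hi₀ : ∫ x, φ₀ x = 1 := B.integral_normed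
  have hK₀ : (tsupport φ₀).Nonempty := by
    by_contra hne
    rw [not_nonempty_iff_eq_empty, tsupport_eq_empty_iff] at hne
    rw [hne] at hi₀
    simp at hi₀
  set c : ℂ := ∫ x in Ioo (0 : ℝ) 1, φ₀ x • f x with hc
  refine ⟨c, Lp.ext ((Filter.EventuallyEq.trans ?_ (pol_one_eq c).symm))⟩
  have hf := integrable_coeFn f
  have hfc : Integrable (fun x => f x - c) mu := hf.sub (integrable_const c)
  have key : ∀ᵐ x ∂(volume : Measure ℝ), x ∈ Ioo (0 : ℝ) 1 → f x - c = 0 := by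
    refine isOpen_Ioo.ae_eq_zero_of_integral_contDiff_smul_eq_zero
      (IntegrableOn.locallyIntegrableOn hfc) ?_
    intro ψ hψ hcψ hsψ
    have e : ∀ g : ℝ → ℂ, ∫ x, ψ x • g x = ∫ x in Ioo (0 : ℝ) 1, ψ x • g x := by
      intro g
      refine (setIntegral_eq_integral_of_forall_compl_eq_zero fun x hx => ?_).symm
      rw [image_eq_zero_of_notMem_tsupport fun hx' => hx (hsψ hx'), zero_smul]
    set m : ℝ := ∫ x, ψ x with hm
    -- Subtracting `m φ₀`, where `φ₀` has integral `1`, removes the mean of `ψ`, so that the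
    -- difference is the derivative of a test function.
    obtain ⟨φ, hφ, hcφ, hsφ, hdφ⟩ := exists_test_primitive (η := fun x => ψ x - m * φ₀ x)
      (hψ.sub (contDiff_const.mul hφ₀)) (hcψ.isCompact.union hc₀.isCompact)
      (hK₀.mono subset_union_right) (union_subset hsψ hs₀) (by
        intro x hx
        by_contra hx'
        rw [mem_union, not_or] at hx'
        refine hx ?_
        change ψ x - m * φ₀ x = 0
        rw [image_eq_zero_of_notMem_tsupport hx'.1, image_eq_zero_of_notMem_tsupport hx'.2]
        simp) (by
        rw [integral_sub (hψ.continuous.integrable_of_hasCompactSupport hcψ)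
          ((hφ₀.continuous.integrable_of_hasCompactSupport hc₀).const_mul m),
          integral_const_mul, hi₀, mul_one, sub_self])
    have h1 := h φ hφ hcφ hsφ
    have h2 : ∫ x in Ioo (0 : ℝ) 1, φ x • (0 : L2) x = 0 := by
      rw [integral_congr_ae (g := fun _ => (0 : ℂ)), integral_zero]
      filter_upwards [Lp.coeFn_zero ℂ 2 mu] with x hx
      rw [hx]; simp
    have hi1 := integrable_test f hψ.continuous hcψ
    have hi2 := integrable_test f hφ₀.continuous hc₀
    rw [h2, mul_zero, iteratedDeriv_one, hdφ] at h1
    simp only [sub_smul, mul_smul] at h1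
    rw [integral_sub hi1 (by exact hi2.smul m), integral_smul, sub_eq_zero] at h1
    rw [e]
    simp only [smul_sub]
    rw [integral_sub hi1, h1, ← e (fun _ => c), integral_smul_const, sub_self]
    exact ((hψ.continuous.integrable_of_hasCompactSupport hcψ).smul_const c).integrableOn
  filter_upwards [(ae_restrict_iff' measurableSet_Ioo).2 key] with x hx
  exact sub_eq_zero.1 hx

theorem IsWeakDeriv.unique {j : ℕ} {f g g' : L2} (h : IsWeakDeriv j f g)
    (h' : IsWeakDeriv j f g') : g = g' := by
  have := h.add (h'.smul (-1))
  rw [neg_one_smul, neg_one_smul, add_neg_cancel] at this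
  exact eq_of_sub_eq_zero ((sub_eq_add_neg g g').trans this.eq_zero)

theorem isWeakDeriv_zero_iff {f g : L2} : IsWeakDeriv 0 f g ↔ f = g := by
  have hrefl : IsWeakDeriv 0 f f := fun φ _ _ _ => by simp
  exact ⟨fun h => hrefl.unique h, fun h => h ▸ hrefl⟩

theorem test_iteratedDeriv (j : ℕ) {φ : ℝ → ℝ} (hφ : ContDiff ℝ ∞ φ) :
    ContDiff ℝ ∞ (iteratedDeriv j φ) ∧ tsupport (iteratedDeriv j φ) ⊆ tsupport φ := by
  induction j with
  | zero => simpa using hφ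
  | succ j ih =>
    rw [iteratedDeriv_succ]
    exact ⟨(contDiff_infty_iff_deriv.1 ih.1).2, tsupport_deriv_subset.trans ih.2⟩

/-- Weak derivatives may be taken successively. -/
theorem IsWeakDeriv.trans_iff {i : ℕ} {f g : L2} (h : IsWeakDeriv i f g) (j : ℕ) {k : L2} :
    IsWeakDeriv j g k ↔ IsWeakDeriv (i + j) f k := by
  refine forall_congr' fun φ => forall_congr' fun hφ => forall_congr' fun hc =>
    forall_congr' fun hs => ?_
  obtain ⟨h1, h2⟩ := test_iteratedDeriv j hφ
  have h3 := h _ h1 (hc.mono' (subset_tsupport _ |>.trans h2)) (h2.trans hs)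
  have e : iteratedDeriv i (iteratedDeriv j φ) = iteratedDeriv (i + j) φ := by
    rw [iteratedDeriv_eq_iterate, iteratedDeriv_eq_iterate, iteratedDeriv_eq_iterate,
      Function.iterate_add_apply]
  rw [e] at h3
  rw [h3, pow_add, mul_assoc]
  exact (mul_right_injective₀ (pow_ne_zero i (by simp : (-1 : ℂ) ≠ 0))).eq_iff.symm

theorem IsWeakDeriv.exists_eq_volterra {f g : L2} (h : IsWeakDeriv 1 f g) :
    ∃ c : ℂ, f = volterra g + c • pol 1 := by
  have h1 := h.add ((isWeakDeriv_volterra g).smul (-1))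
  rw [neg_one_smul, neg_one_smul, add_neg_cancel] at h1
  obtain ⟨c, hc⟩ := h1.exists_eq_const
  exact ⟨c, by rw [← hc]; abel⟩

theorem isWeakDeriv_volterra_add_const (f : L2) (c : ℂ) :
    IsWeakDeriv 1 (volterra f + c • pol 1) f := by
  have := (isWeakDeriv_volterra f).add ((isWeakDeriv_pol 1).smul c)
  rwa [derivative_one, map_zero, smul_zero, add_zero] at this

/-- The continuous representative is unique on the closed interval, and here its value at `0` is the
integration constant. -/
theorem vanishesAtZero_volterra_add_const {f : L2} {c : ℂ} :
    VanishesAtZero (volterra f + c • pol 1) ↔ c = 0 := by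
  have hc : ContinuousOn (fun x => (∫ t in (0 : ℝ)..x, f t) + c) (Icc 0 1) :=
    (continuousOn_primitive f).add continuousOn_const
  have hr : (volterra f + c • pol 1 : L2) =ᵐ[mu] fun x => (∫ t in (0 : ℝ)..x, f t) + c := by
    filter_upwards [Lp.coeFn_add (volterra f) (c • pol 1), coeFn_volterra f, pol_one_eq c]
      with x h1 h2 h3
    rw [h1, Pi.add_apply, h2, h3]
  constructor
  · rintro ⟨g, hg, he, h0⟩
    have h1 : EqOn g (fun x => (∫ t in (0 : ℝ)..x, f t) + c) (Icc 0 1) := by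
      refine Measure.eqOn_Icc_of_ae_eq volume zero_ne_one ?_ hg hc
      rw [← Measure.restrict_congr_set Ioo_ae_eq_Icc]
      exact he.symm.trans hr
    have h2 := h1 (left_mem_Icc.2 zero_le_one)
    simpa [h0] using h2.symm
  · rintro rfl
    exact ⟨_, hc, hr, by simp⟩

theorem mem_sobolev {m : ℕ} {f : L2} : f ∈ sobolev m ↔ ∀ j ≤ m, ∃ g, IsWeakDeriv j f g := by
  simp only [← mem_weakDeriv_graph, ← LinearPMap.mem_domain_iff]
  rfl

theorem isWeakDeriv_succ_iff {j : ℕ} {g h : L2} {c : ℂ} :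
    IsWeakDeriv (j + 1) (volterra g + c • pol 1) h ↔ IsWeakDeriv j g h := by
  rw [add_comm j, (isWeakDeriv_volterra_add_const g c).trans_iff]

theorem mem_sobolev_zero (f : L2) : f ∈ sobolev 0 :=
  mem_sobolev.2 fun j hj => ⟨f, by rw [Nat.le_zero.1 hj]; exact isWeakDeriv_zero_iff.2 rfl⟩

theorem volterra_add_const_mem_sobolev_iff {m : ℕ} {g : L2} {c : ℂ} :
    volterra g + c • pol 1 ∈ sobolev (m + 1) ↔ g ∈ sobolev m := by
  rw [mem_sobolev, mem_sobolev]
  constructor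
  · intro h j hj
    obtain ⟨k, hk⟩ := h (j + 1) (by omega)
    exact ⟨k, isWeakDeriv_succ_iff.1 hk⟩
  · intro h j hj
    rcases j with - | j
    · exact ⟨_, isWeakDeriv_zero_iff.2 rfl⟩
    · obtain ⟨k, hk⟩ := h j (by omega)
      exact ⟨k, isWeakDeriv_succ_iff.2 hk⟩

theorem exists_of_mem_sobolev_succ {m : ℕ} {f : L2} (h : f ∈ sobolev (m + 1)) :
    ∃ (g : L2) (c : ℂ), g ∈ sobolev m ∧ f = volterra g + c • pol 1 := by
  obtain ⟨g, hg⟩ := mem_sobolev.1 h 1 (by omega)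
  obtain ⟨c, rfl⟩ := hg.exists_eq_volterra
  exact ⟨g, c, volterra_add_const_mem_sobolev_iff.1 h, rfl⟩

theorem mem_zeroTrace_succ_iff {j : ℕ} {g : L2} {c : ℂ} :
    volterra g + c • pol 1 ∈ zeroTrace (j + 1) ↔ g ∈ zeroTrace j :=
  exists_congr fun _ => and_congr_left' isWeakDeriv_succ_iff

theorem mem_zeroTrace_zero_iff {g : L2} {c : ℂ} :
    volterra g + c • pol 1 ∈ zeroTrace 0 ↔ c = 0 := by
  rw [← vanishesAtZero_volterra_add_const (f := g)]
  constructor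
  · rintro ⟨h, h1, h2⟩
    rwa [isWeakDeriv_zero_iff.1 h1]
  · exact fun h => ⟨_, isWeakDeriv_zero_iff.2 rfl, h⟩

/-! ### Structure and completeness of `𝓗^{2k}` -/

theorem volterra_pol_one : volterra (pol 1) = pol Polynomial.X := by
  simpa using volterra_pol_derivative Polynomial.X

/-- The double Volterra operator in both components. -/
def volterraSq : H →L[ℂ] H :=
  (WithLp.prodContinuousLinearEquiv 2 ℂ L2 L2).symm.toContinuousLinearMap ∘L
    ((volterra ∘L volterra).prodMap (volterra ∘L volterra)) ∘L
    (WithLp.prodContinuousLinearEquiv 2 ℂ L2 L2).toContinuousLinearMap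

/-- The pair `(ρ, 0)`. -/
def oddUnit : H := WithLp.toLp 2 (pol Polynomial.X, 0)

/-- The pair `(0, 1)`. -/
def evenUnit : H := WithLp.toLp 2 (0, pol 1)

/-- `u ∈ 𝓗^{2k}` and `g = D^{2k} u`. -/
def IsD (k : ℕ) (u g : H) : Prop :=
  u ∈ hSub k ∧ IsWeakDeriv (2 * k) u.fst g.fst ∧ IsWeakDeriv (2 * k) u.snd g.snd

theorem H_ext {u v : H} (h1 : u.fst = v.fst) (h2 : u.snd = v.snd) : u = v :=
  WithLp.ofLp_injective 2 (Prod.ext h1 h2)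

theorem fst_volterraSq_add (g : H) (c d : ℂ) :
    (volterraSq g + (c • oddUnit + d • evenUnit)).fst =
      volterra (volterra g.fst + c • pol 1) + (0 : ℂ) • pol 1 := by
  rw [map_add, map_smul, volterra_pol_one, zero_smul, add_zero]
  change volterra (volterra g.fst) + (c • pol Polynomial.X + d • 0) = _
  rw [smul_zero, add_zero]

theorem snd_volterraSq_add (g : H) (c d : ℂ) :
    (volterraSq g + (c • oddUnit + d • evenUnit)).snd =
      volterra (volterra g.snd + (0 : ℂ) • pol 1) + d • pol 1 := by
  rw [zero_smul, add_zero]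
  change volterra (volterra g.snd) + (c • 0 + d • pol 1) = _
  rw [smul_zero, zero_add]

theorem volterraSq_add_mem_hSub_iff {k : ℕ} {g : H} {c d : ℂ} :
    volterraSq g + (c • oddUnit + d • evenUnit) ∈ hSub (k + 1) ↔ g ∈ hSub k := by
  change (_ ∧ _ ∧ _) ↔ (_ ∧ _ ∧ _)
  rw [fst_volterraSq_add, snd_volterraSq_add, show 2 * (k + 1) = 2 * k + 1 + 1 by ring,
    volterra_add_const_mem_sobolev_iff, volterra_add_const_mem_sobolev_iff,
    volterra_add_const_mem_sobolev_iff, volterra_add_const_mem_sobolev_iff]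
  refine and_congr_right fun _ => and_congr_right fun _ => ?_
  constructor
  · intro h j hj
    have := h (j + 1) (by omega)
    rwa [show 2 * (j + 1) = 2 * j + 1 + 1 by ring, mem_zeroTrace_succ_iff, mem_zeroTrace_succ_iff,
      mem_zeroTrace_succ_iff, mem_zeroTrace_succ_iff] at this
  · intro h j hj
    rcases j with - | j
    · exact ⟨mem_zeroTrace_zero_iff.2 rfl, mem_zeroTrace_succ_iff.2 (mem_zeroTrace_zero_iff.2 rfl)⟩
    · have := h j (by omega)
      rwa [show 2 * (j + 1) = 2 * j + 1 + 1 by ring, mem_zeroTrace_succ_iff,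
        mem_zeroTrace_succ_iff, mem_zeroTrace_succ_iff, mem_zeroTrace_succ_iff]

/-- Integrating each component twice brings in four constants. The condition `u₁(0) = 0` kills the
outer one of `u₁` and `u₂'(0) = 0` the inner one of `u₂`; the other two multiply `(ρ, 0)` and `(0,
1)`. -/
theorem exists_of_mem_hSub_succ {k : ℕ} {u : H} (hu : u ∈ hSub (k + 1)) :
    ∃ (g : H) (c d : ℂ), u = volterraSq g + (c • oddUnit + d • evenUnit) := by
  obtain ⟨h1, h2, h3⟩ := hu
  obtain ⟨f₁, c₁, hf₁, e₁⟩ := exists_of_mem_sobolev_succ (m := 2 * k + 1) h1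
  obtain ⟨g₁, d₁, -, rfl⟩ := exists_of_mem_sobolev_succ (m := 2 * k) hf₁
  obtain ⟨f₂, c₂, hf₂, e₂⟩ := exists_of_mem_sobolev_succ (m := 2 * k + 1) h2
  obtain ⟨g₂, d₂, -, rfl⟩ := exists_of_mem_sobolev_succ (m := 2 * k) hf₂
  obtain ⟨h4, h5⟩ := h3 0 (by omega)
  rw [e₁, mem_zeroTrace_zero_iff] at h4
  rw [e₂, mem_zeroTrace_succ_iff, mem_zeroTrace_zero_iff] at h5
  subst h4 h5
  refine ⟨WithLp.toLp 2 (g₁, g₂), d₁, c₂, H_ext ?_ ?_⟩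
  · rw [fst_volterraSq_add, e₁]; rfl
  · rw [snd_volterraSq_add, e₂]; rfl

theorem isD_volterraSq_add_iff {k : ℕ} {g h : H} {c d : ℂ} :
    IsD (k + 1) (volterraSq g + (c • oddUnit + d • evenUnit)) h ↔ IsD k g h := by
  rw [IsD, IsD, volterraSq_add_mem_hSub_iff, fst_volterraSq_add, snd_volterraSq_add,
    show 2 * (k + 1) = 2 * k + 1 + 1 by ring, isWeakDeriv_succ_iff, isWeakDeriv_succ_iff,
    isWeakDeriv_succ_iff, isWeakDeriv_succ_iff]

theorem isD_zero_iff {u g : H} : IsD 0 u g ↔ u = g := by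
  simp only [IsD, mul_zero, isWeakDeriv_zero_iff]
  constructor
  · exact fun h => H_ext h.2.1 h.2.2
  · rintro rfl
    exact ⟨⟨mem_sobolev_zero _, mem_sobolev_zero _, fun j hj => absurd hj (Nat.not_lt_zero j)⟩,
      rfl, rfl⟩

/-- The kernel of `D^{2k}` in `𝓗^{2k}`. -/
def kerD : ℕ → Submodule ℂ H
  | 0 => ⊥
  | k + 1 => (kerD k).map (volterraSq : H →ₗ[ℂ] H) ⊔ Submodule.span ℂ {oddUnit, evenUnit}

instance finiteDimensional_kerD (k : ℕ) : FiniteDimensional ℂ (kerD k) := by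
  induction k with
  | zero => rw [kerD]; infer_instance
  | succ k ih =>
    rw [kerD]
    have : FiniteDimensional ℂ (Submodule.span ℂ {oddUnit, evenUnit}) :=
      FiniteDimensional.span_of_finite ℂ (by simp)
    infer_instance

/-- Two derivatives and two boundary conditions are peeled off at each step of the induction. The
result encodes regularity and boundary values without any mention of intermediate derivatives. -/
theorem isD_iff {k : ℕ} {u g : H} : IsD k u g ↔ u - (volterraSq ^ k) g ∈ kerD k := by
  induction k generalizing u g with
  | zero => rw [isD_zero_iff, kerD, Submodule.mem_bot, pow_zero, sub_eq_zero]; rfl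
  | succ k ih =>
    rw [kerD, Submodule.mem_sup, pow_succ']
    constructor
    · intro h
      obtain ⟨f, c, d, rfl⟩ := exists_of_mem_hSub_succ h.1
      refine ⟨_, Submodule.mem_map_of_mem (ih.1 (isD_volterraSq_add_iff.1 h)), _,
        Submodule.mem_span_pair.2 ⟨c, d, rfl⟩, ?_⟩
      rw [ContinuousLinearMap.coe_coe, map_sub]
      change _ = _ - volterraSq ((volterraSq ^ k) g)
      abel
    · rintro ⟨_, ⟨f, hf, rfl⟩, _, hs, he⟩
      obtain ⟨c, d, rfl⟩ := Submodule.mem_span_pair.1 hs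
      have hu : u = volterraSq (f + (volterraSq ^ k) g) + (c • oddUnit + d • evenUnit) := by
        rw [map_add]
        change _ = u - volterraSq ((volterraSq ^ k) g) at he
        rw [eq_sub_iff_add_eq] at he
        rw [← he, ContinuousLinearMap.coe_coe]
        abel
      rw [hu, isD_volterraSq_add_iff, ih, add_sub_cancel_right]
      exact hf

/-- A finite-dimensional subspace is closed and `volterraSq ^ k` is bounded, so no interpolation
estimate for intermediate derivatives or traces is needed. -/
theorem isClosed_isD (k : ℕ) : IsClosed {p : H × H | IsD k p.1 p.2} := by
  simp only [isD_iff]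
  exact (Submodule.closed_of_finiteDimensional (kerD k)).preimage
    (continuous_fst.sub ((volterraSq ^ k).continuous.comp continuous_snd))

theorem isD_incl_iff {k : ℕ} {u : HSpace k} {g : H} : IsD k (incl k u) g ↔ D2k k u = g := by
  have h : IsD k (incl k u) (D2k k u) :=
    ⟨u.2, mem_weakDeriv_graph.1 (LinearPMap.mem_graph _ ⟨_, u.2.1 (2 * k) le_rfl⟩),
      mem_weakDeriv_graph.1 (LinearPMap.mem_graph _ ⟨_, u.2.2.1 (2 * k) le_rfl⟩)⟩
  exact ⟨fun h' => H_ext (h.2.1.unique h'.2.1) (h.2.2.unique h'.2.2), fun e => e ▸ h⟩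

theorem norm_sq_hSpace (k : ℕ) (u : HSpace k) :
    ‖u‖ ^ 2 = ‖incl k u‖ ^ 2 + ‖D2k k u‖ ^ 2 := by
  rw [← inner_self_eq_norm_sq (𝕜 := ℂ), ← inner_self_eq_norm_sq (𝕜 := ℂ) (incl k u),
    ← inner_self_eq_norm_sq (𝕜 := ℂ) (D2k k u), inner_def, map_add]

theorem norm_incl_le (k : ℕ) (u : HSpace k) : ‖incl k u‖ ≤ ‖u‖ := by
  refine abs_le_of_sq_le_sq' ?_ (norm_nonneg _) |>.2
  rw [norm_sq_hSpace]
  nlinarith [norm_nonneg (D2k k u)]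

theorem continuous_incl (k : ℕ) : Continuous (incl k) :=
  AddMonoidHomClass.continuous_of_bound (incl k) 1 fun u => by
    rw [one_mul]; exact norm_incl_le k u

/-- The isometry `u ↦ (u, D^{2k} u)`. -/
def graphIsometry (k : ℕ) : HSpace k →ₗᵢ[ℂ] WithLp 2 (H × H) where
  toLinearMap := (WithLp.linearEquiv 2 ℂ (H × H)).symm.toLinearMap ∘ₗ (incl k).prod (D2k k)
  norm_map' u := by
    rw [← sq_eq_sq₀ (norm_nonneg _) (norm_nonneg _), norm_sq_hSpace, WithLp.prod_norm_sq_eq_of_L2]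
    rfl

theorem completeSpace_hSpace (k : ℕ) : CompleteSpace (HSpace k) := by
  rw [completeSpace_iff_isComplete_range (graphIsometry k).isometry.isUniformInducing]
  refine IsClosed.isComplete ?_
  have h : range (graphIsometry k) =
      (WithLp.prodContinuousLinearEquiv 2 ℂ H H) ⁻¹' {p : H × H | IsD k p.1 p.2} := by
    ext p
    constructor
    · rintro ⟨u, rfl⟩
      exact isD_incl_iff.2 rfl
    · intro hp
      refine ⟨⟨p.fst, hp.1⟩, WithLp.ofLp_injective 2 (Prod.ext rfl ?_)⟩
      exact isD_incl_iff.1 hp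
  rw [h]
  exact (isClosed_isD k).preimage (ContinuousLinearEquiv.continuous _)

/-! ### Parity, and density of polynomials in `𝓗^{2k}` -/

/-- The odd part of a polynomial. -/
def oddPart : ℂ[X] →ₗ[ℂ] ℂ[X] :=
  (1 / 2 : ℂ) • (LinearMap.id - (aeval (-Polynomial.X : ℂ[X])).toLinearMap)

/-- The even part of a polynomial. -/
def evenPart : ℂ[X] →ₗ[ℂ] ℂ[X] :=
  (1 / 2 : ℂ) • (LinearMap.id + (aeval (-Polynomial.X : ℂ[X])).toLinearMap)

theorem oddPart_apply (p : ℂ[X]) :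
    oddPart p = (1 / 2 : ℂ) • (p - p.comp (-Polynomial.X)) := rfl

theorem evenPart_apply (p : ℂ[X]) :
    evenPart p = (1 / 2 : ℂ) • (p + p.comp (-Polynomial.X)) := rfl

theorem derivative_oddPart (p : ℂ[X]) : derivative (oddPart p) = evenPart (derivative p) := by
  simp [oddPart_apply, evenPart_apply, derivative_comp]

theorem derivative_evenPart (p : ℂ[X]) : derivative (evenPart p) = oddPart (derivative p) := by
  simp [oddPart_apply, evenPart_apply, derivative_comp, sub_eq_add_neg]

theorem eval_zero_oddPart (p : ℂ[X]) : (oddPart p).eval 0 = 0 := by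
  simp [oddPart_apply, eval_comp]

theorem eval_zero_evenPart (p : ℂ[X]) : (evenPart p).eval 0 = p.eval 0 := by
  simp [evenPart_apply, eval_comp]
  ring

/-- The element of `𝓗` given by the odd and the even part of a polynomial. -/
def polH : ℂ[X] →ₗ[ℂ] H :=
  (WithLp.linearEquiv 2 ℂ (L2 × L2)).symm.toLinearMap ∘ₗ (pol ∘ₗ oddPart).prod (pol ∘ₗ evenPart)

theorem fst_polH (p : ℂ[X]) : (polH p).fst = pol (oddPart p) := rfl

theorem snd_polH (p : ℂ[X]) : (polH p).snd = pol (evenPart p) := rfl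

/-- Second-order Taylor formula at `0`, by parity: the odd part has no constant term and the even
part no linear term. -/
theorem polH_eq (p : ℂ[X]) :
    polH p = volterraSq (polH (derivative (derivative p))) +
      ((derivative p).eval 0 • oddUnit + p.eval 0 • evenUnit) := by
  refine H_ext ?_ ?_
  · rw [fst_volterraSq_add, fst_polH, fst_polH, ← derivative_evenPart, ← derivative_oddPart,
      volterra_pol_derivative, derivative_oddPart, eval_zero_evenPart, sub_add_cancel,
      ← derivative_oddPart, volterra_pol_derivative, eval_zero_oddPart]
    simp
  · rw [snd_volterraSq_add, snd_polH, snd_polH, ← derivative_oddPart, ← derivative_evenPart,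
      volterra_pol_derivative, derivative_evenPart, eval_zero_oddPart, sub_add_cancel,
      ← derivative_evenPart, volterra_pol_derivative, eval_zero_evenPart, sub_add_cancel]

theorem isD_polH (k : ℕ) (p : ℂ[X]) : IsD k (polH p) (polH (derivative^[2 * k] p)) := by
  induction k generalizing p with
  | zero => exact isD_zero_iff.2 rfl
  | succ k ih =>
    rw [polH_eq p, isD_volterraSq_add_iff]
    exact ih _

theorem polH_X_pow_odd (n : ℕ) :
    polH (Polynomial.X ^ (2 * n + 1)) = WithLp.toLp 2 (pol (Polynomial.X ^ (2 * n + 1)), 0) := by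
  have h : (-Polynomial.X : ℂ[X]) ^ (2 * n + 1) = -Polynomial.X ^ (2 * n + 1) :=
    Odd.neg_pow ⟨n, rfl⟩ _
  refine H_ext ?_ ?_
  · rw [fst_polH, oddPart_apply, X_pow_comp, h, sub_neg_eq_add, ← two_smul ℂ, smul_smul]
    norm_num
  · rw [snd_polH, evenPart_apply, X_pow_comp, h, add_neg_cancel, smul_zero, map_zero]
    rfl

theorem polH_X_pow_even (n : ℕ) :
    polH (Polynomial.X ^ (2 * n)) = WithLp.toLp 2 (0, pol (Polynomial.X ^ (2 * n))) := by
  have h : (-Polynomial.X : ℂ[X]) ^ (2 * n) = Polynomial.X ^ (2 * n) :=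
    Even.neg_pow (even_two_mul n) _
  refine H_ext ?_ ?_
  · rw [fst_polH, oddPart_apply, X_pow_comp, h, sub_self, smul_zero, map_zero]
    rfl
  · rw [snd_polH, evenPart_apply, X_pow_comp, h, ← two_smul ℂ, smul_smul]
    norm_num

theorem oddUnit_mem : oddUnit ∈ LinearMap.range polH :=
  ⟨Polynomial.X ^ (2 * 0 + 1), (polH_X_pow_odd 0).trans (by simp [oddUnit])⟩

theorem evenUnit_mem : evenUnit ∈ LinearMap.range polH :=
  ⟨Polynomial.X ^ (2 * 0), (polH_X_pow_even 0).trans (by simp [evenUnit])⟩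

theorem volterraSq_mem {u : H} (hu : u ∈ LinearMap.range polH) :
    volterraSq u ∈ LinearMap.range polH := by
  obtain ⟨p, rfl⟩ := hu
  obtain ⟨q, rfl⟩ := exists_derivative_eq p
  obtain ⟨r, rfl⟩ := exists_derivative_eq q
  rw [← sub_eq_iff_eq_add.2 (polH_eq r)]
  exact Submodule.sub_mem _ ⟨r, rfl⟩ (Submodule.add_mem _ (Submodule.smul_mem _ _ oddUnit_mem)
    (Submodule.smul_mem _ _ evenUnit_mem))

theorem volterraSq_pow_mem (k : ℕ) {u : H} (hu : u ∈ LinearMap.range polH) :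
    (volterraSq ^ k) u ∈ LinearMap.range polH := by
  induction k with
  | zero => exact hu
  | succ k ih =>
    rw [pow_succ']
    exact volterraSq_mem ih

theorem kerD_le (k : ℕ) : kerD k ≤ LinearMap.range polH := by
  induction k with
  | zero => exact bot_le
  | succ k ih =>
    rw [kerD, sup_le_iff, Submodule.span_le, Submodule.map_le_iff_le_comap]
    refine ⟨fun u hu => volterraSq_mem (ih hu), ?_⟩
    rintro _ (rfl | rfl)
    exacts [oddUnit_mem, evenUnit_mem]

theorem denseRange_polH : DenseRange polH := by
  have h : (LinearMap.range polH).topologicalClosure = ⊤ := by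
    rw [Submodule.topologicalClosure_eq_top_iff, Submodule.eq_bot_iff]
    intro f hf
    refine H_ext (eq_zero_of_inner_odd fun n => ?_) (eq_zero_of_inner_even fun n => ?_)
    · have := hf _ ⟨Polynomial.X ^ (2 * n + 1), rfl⟩
      rw [polH_X_pow_odd, WithLp.prod_inner_apply] at this
      simpa using this
    · have := hf _ ⟨Polynomial.X ^ (2 * n), rfl⟩
      rw [polH_X_pow_even, WithLp.prod_inner_apply] at this
      simpa using this
  have := (Submodule.dense_iff_topologicalClosure_eq_top).2 h
  rwa [LinearMap.coe_range] at this

/-- The element of `𝓗` that belongs to the polynomial `q(1 - ρ)`. -/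
def profile : ℂ[X] →ₗ[ℂ] H := polH ∘ₗ (aeval (1 - Polynomial.X : ℂ[X])).toLinearMap

theorem profile_apply (q : ℂ[X]) : profile q = polH (q.comp (1 - Polynomial.X)) := rfl

theorem range_profile : LinearMap.range profile = LinearMap.range polH := by
  refine le_antisymm (LinearMap.range_comp_le_range _ _) ?_
  rintro _ ⟨p, rfl⟩
  refine ⟨p.comp (1 - Polynomial.X), ?_⟩
  rw [profile_apply, comp_assoc]
  simp

theorem denseRange_profile : DenseRange profile := by
  rw [DenseRange, ← LinearMap.coe_range, range_profile, LinearMap.coe_range]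
  exact denseRange_polH

/-- The substitution `1 - ρ` contributes a factor `-1` per derivative, and their number `2k` is
even. -/
theorem isD_profile (k : ℕ) (q : ℂ[X]) :
    IsD k (profile q) (profile (derivative^[2 * k] q)) := by
  have h := isD_polH k (q.comp (1 - Polynomial.X))
  rwa [iterate_derivative_comp_one_sub_X, (even_two_mul k).neg_one_pow, one_mul] at h

/-- `profile` as a map to `𝓗^{2k}`. -/
def profileK (k : ℕ) : ℂ[X] →ₗ[ℂ] HSpace k :=
  LinearMap.codRestrict (hSub k) profile fun q => (isD_profile k q).1

theorem incl_profileK (k : ℕ) (q : ℂ[X]) : incl k (profileK k q) = profile q := rfl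

theorem D2k_profileK (k : ℕ) (q : ℂ[X]) :
    D2k k (profileK k q) = profile (derivative^[2 * k] q) :=
  isD_incl_iff.1 (isD_profile k q)

theorem denseRange_profileK (k : ℕ) : DenseRange (profileK k) := by
  intro u
  have hu : IsD k (incl k u) (D2k k u) := isD_incl_iff.2 rfl
  obtain ⟨f, hf, hlim⟩ := mem_closure_iff_seq_limit.1 (denseRange_profile (D2k k u))
  -- Approximate only `D^{2k} u`, by polynomials `f n`, integrate back, and keep the kernel part of
  -- `u`, which is itself polynomial.
  have hmem : ∀ n, (volterraSq ^ k) (f n) + (incl k u - (volterraSq ^ k) (D2k k u)) ∈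
      LinearMap.range profile := fun n => by
    have h := hf n
    rw [← LinearMap.coe_range, SetLike.mem_coe, range_profile] at h
    rw [range_profile]
    exact Submodule.add_mem _ (volterraSq_pow_mem k h) (kerD_le k (isD_iff.1 hu))
  choose q hq using hmem
  have hD : ∀ n, D2k k (profileK k (q n)) = f n := fun n => by
    rw [← isD_incl_iff, incl_profileK, hq, isD_iff, add_sub_cancel_left]
    exact isD_iff.1 hu
  refine mem_closure_iff_seq_limit.2 ⟨fun n => profileK k (q n), fun n => ⟨q n, rfl⟩, ?_⟩
  rw [tendsto_iff_norm_sub_tendsto_zero]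
  have h1 : Tendsto (fun n => ‖(volterraSq ^ k) (f n - D2k k u)‖ ^ 2 + ‖f n - D2k k u‖ ^ 2) atTop
      (𝓝 (‖(volterraSq ^ k) (D2k k u - D2k k u)‖ ^ 2 + ‖D2k k u - D2k k u‖ ^ 2)) := by
    have h2 := hlim.sub_const (D2k k u)
    exact ((((volterraSq ^ k).continuous.tendsto _).comp h2).norm.pow 2).add (h2.norm.pow 2)
  rw [sub_self, map_zero, norm_zero, zero_pow two_ne_zero, add_zero] at h1
  have h3 := (Real.continuous_sqrt.tendsto 0).comp h1
  rw [Real.sqrt_zero] at h3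
  refine h3.congr fun n => ?_
  rw [Function.comp_apply, ← Real.sqrt_sq (norm_nonneg (profileK k (q n) - u)), norm_sq_hSpace,
    map_sub (incl k), map_sub (D2k k), hD, incl_profileK, hq, map_sub (volterraSq ^ k)]
  congr 4
  abel

/-! ### The operator on polynomials and its dissipativity -/

theorem oddPart_one_sub_X_mul (r : ℂ[X]) :
    oddPart ((1 - Polynomial.X) * r) = -Polynomial.X * evenPart r + oddPart r := by
  simp only [oddPart_apply, evenPart_apply, mul_comp, sub_comp, one_comp, X_comp, smul_eq_C_mul]
  ring

theorem evenPart_one_sub_X_mul (r : ℂ[X]) :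
    evenPart ((1 - Polynomial.X) * r) = evenPart r - Polynomial.X * oddPart r := by
  simp only [oddPart_apply, evenPart_apply, mul_comp, sub_comp, one_comp, X_comp, smul_eq_C_mul]
  ring

theorem der_eval (p : ℂ[X]) {x : ℝ} (hx : x ∈ Ioo (0 : ℝ) 1) :
    der (fun x : ℝ => p.eval (x : ℂ)) x = (derivative p).eval (x : ℂ) :=
  (hasDerivAt_eval_ofReal p x).hasDerivWithinAt.derivWithin
    (uniqueDiffOn_Icc zero_lt_one x (Ioo_subset_Icc_self hx))

theorem contDiff_eval_ofReal (p : ℂ[X]) : ContDiff ℝ 1 fun x : ℝ => p.eval (x : ℂ) := by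
  rw [contDiff_one_iff_deriv]
  refine ⟨fun x => (hasDerivAt_eval_ofReal p x).differentiableAt, ?_⟩
  rw [show deriv (fun x : ℝ => p.eval (x : ℂ)) = fun x : ℝ => (derivative p).eval (x : ℂ) from
    funext fun x => (hasDerivAt_eval_ofReal p x).deriv]
  exact continuous_eval_ofReal _

/-- For `p(ρ) = q(1 - ρ)`, the odd and even parts of `(1 - ρ) p'` are the two components of `L̃₀`,
while `(1 - ρ) p'` is `-y q'(y)` at `y = 1 - ρ`. -/
theorem isLtilde_profile (q : ℂ[X]) : IsLtilde (profile q) (-profile (euler q)) := by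
  set p := q.comp (1 - Polynomial.X) with hp
  have e : -profile (euler q) = polH ((1 - Polynomial.X) * derivative p) := by
    rw [profile_apply, ← map_neg, hp, derivative_comp, euler, LinearMap.comp_apply,
      LinearMap.mulLeft_apply, mul_comp, X_comp]
    congr 1
    simp
  rw [e]
  refine ⟨fun x => (oddPart p).eval (x : ℂ), fun x => (evenPart p).eval (x : ℂ),
    ⟨(contDiff_eval_ofReal _).contDiffOn, (contDiff_eval_ofReal _).contDiffOn, ?_,
      coeFn_pol _, coeFn_pol _⟩, ?_, ?_⟩
  · simp [eval_zero_oddPart]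
  · rw [fst_polH, oddPart_one_sub_X_mul]
    filter_upwards [coeFn_pol (-Polynomial.X * evenPart (derivative p) + oddPart (derivative p)),
      ae_restrict_mem measurableSet_Ioo] with x h1 hx
    rw [h1, der_eval _ hx, der_eval _ hx, derivative_oddPart, derivative_evenPart]
    simp
  · rw [snd_polH, evenPart_one_sub_X_mul]
    filter_upwards [coeFn_pol (evenPart (derivative p) - Polynomial.X * oddPart (derivative p)),
      ae_restrict_mem measurableSet_Ioo] with x h1 hx
    rw [h1, der_eval _ hx, der_eval _ hx, derivative_oddPart, derivative_evenPart]
    simp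

theorem re_inner_eq_integral (u v : H) :
    RCLike.re (inner ℂ u v) = ∫ x, (RCLike.re (inner ℂ (u.fst x) (v.fst x)) +
      RCLike.re (inner ℂ (u.snd x) (v.snd x))) ∂mu := by
  rw [WithLp.prod_inner_apply, map_add, L2.inner_def, L2.inner_def,
    integral_add (L2.integrable_inner _ _).re (L2.integrable_inner _ _).re,
    integral_re (L2.integrable_inner _ _), integral_re (L2.integrable_inner _ _)]
  rfl

/-- `L̃₀ - 1/2` is dissipative. -/
theorem re_inner_le_of_isLtilde {u v : H} (h : IsLtilde u v) :
    RCLike.re (inner ℂ u v) ≤ 1 / 2 * ‖u‖ ^ 2 := by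
  obtain ⟨g₁, g₂, ⟨c1, c2, z, e1, e2⟩, d1, d2⟩ := h
  -- `F = -(x/2)(|g₁|² + |g₂|²) + Re (g₁|g₂)` is a primitive of the integrand of `Re (u|v - ½u)`;
  -- the `-½` absorbs the derivative of the weight `x`.
  let F : ℝ → ℝ := fun x => -(x / 2) * ((g₁ x).re ^ 2 + (g₁ x).im ^ 2 + (g₂ x).re ^ 2 +
    (g₂ x).im ^ 2) + ((g₁ x).re * (g₂ x).re + (g₁ x).im * (g₂ x).im)
  let F' : ℝ → ℝ := fun x => RCLike.re (inner ℂ (g₁ x)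
      (-(x : ℂ) * der g₁ x + der g₂ x - (1 / 2 : ℂ) * g₁ x)) +
    RCLike.re (inner ℂ (g₂ x) (der g₁ x - (x : ℂ) * der g₂ x - (1 / 2 : ℂ) * g₂ x))
  have hF : ContinuousOn F (Icc 0 1) := by
    have r1 := Complex.continuous_re.comp_continuousOn c1.continuousOn
    have r2 := Complex.continuous_re.comp_continuousOn c2.continuousOn
    have i1 := Complex.continuous_im.comp_continuousOn c1.continuousOn
    have i2 := Complex.continuous_im.comp_continuousOn c2.continuousOn
    exact ((continuous_id.div_const 2).neg.continuousOn.mul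
      ((((r1.pow 2).add (i1.pow 2)).add (r2.pow 2)).add (i2.pow 2))).add
      ((r1.mul r2).add (i1.mul i2))
  have hder : ∀ g : ℝ → ℂ, ContDiffOn ℝ 1 g (Icc 0 1) → ∀ x ∈ Ioo (0 : ℝ) 1,
      HasDerivAt g (der g x) x := fun g hg x hx =>
    ((hg.differentiableOn one_ne_zero x (Ioo_subset_Icc_self hx)).hasDerivWithinAt).hasDerivAt
      (Icc_mem_nhds hx.1 hx.2)
  have hF' : ∀ x ∈ Ioo (0 : ℝ) 1, HasDerivAt F (F' x) x := by
    intro x hx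
    have hr : ∀ g : ℝ → ℂ, ContDiffOn ℝ 1 g (Icc 0 1) →
        HasDerivAt (fun x => (g x).re) (der g x).re x := fun g hg =>
      Complex.reCLM.hasFDerivAt.comp_hasDerivAt x (hder g hg x hx)
    have hi : ∀ g : ℝ → ℂ, ContDiffOn ℝ 1 g (Icc 0 1) →
        HasDerivAt (fun x => (g x).im) (der g x).im x := fun g hg =>
      Complex.imCLM.hasFDerivAt.comp_hasDerivAt x (hder g hg x hx)
    have key := (((hasDerivAt_id x).div_const 2).neg.mul
      (((((hr g₁ c1).pow 2).add ((hi g₁ c1).pow 2)).add ((hr g₂ c2).pow 2)).add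
        ((hi g₂ c2).pow 2))).add (((hr g₁ c1).mul (hr g₂ c2)).add ((hi g₁ c1).mul (hi g₂ c2)))
    refine key.congr_deriv ?_
    simp [F']
    ring
  have hae : (fun x => RCLike.re (inner ℂ (u.fst x) ((v - (1 / 2 : ℂ) • u).fst x)) +
      RCLike.re (inner ℂ (u.snd x) ((v - (1 / 2 : ℂ) • u).snd x))) =ᵐ[mu] F' := by
    rw [WithLp.sub_fst, WithLp.sub_snd, WithLp.smul_fst, WithLp.smul_snd]
    filter_upwards [e1, e2, d1, d2, Lp.coeFn_sub v.fst ((1 / 2 : ℂ) • u.fst),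
      Lp.coeFn_sub v.snd ((1 / 2 : ℂ) • u.snd), Lp.coeFn_smul (1 / 2 : ℂ) u.fst,
      Lp.coeFn_smul (1 / 2 : ℂ) u.snd] with x h1 h2 h3 h4 h5 h6 h7 h8
    rw [h5, h6, Pi.sub_apply, Pi.sub_apply, h7, h8, Pi.smul_apply, Pi.smul_apply, h1, h2, h3, h4,
      smul_eq_mul, smul_eq_mul]
  have hint : IntervalIntegrable F' volume 0 1 := by
    rw [intervalIntegrable_iff_integrableOn_Ioo_of_le zero_le_one]
    exact Integrable.congr ((L2.integrable_inner (𝕜 := ℂ) _ _).re.add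
      (L2.integrable_inner (𝕜 := ℂ) _ _).re) hae
  have hI : RCLike.re (inner ℂ u (v - (1 / 2 : ℂ) • u)) = F 1 - F 0 := by
    rw [re_inner_eq_integral, integral_congr_ae hae, ← integral_Ioc_eq_integral_Ioo,
      ← intervalIntegral.integral_of_le zero_le_one,
      intervalIntegral.integral_eq_sub_of_hasDerivAt_of_le zero_le_one hF hF' hint]
  have h0 : F 0 = 0 := by simp [F, z]
  -- In fact `F 1 = -½|g₁(1) - g₂(1)|²`.
  have h1 : F 1 ≤ 0 := by
    simp only [F]
    nlinarith [sq_nonneg ((g₁ 1).re - (g₂ 1).re), sq_nonneg ((g₁ 1).im - (g₂ 1).im)]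
  have h2 := inner_self_eq_norm_sq (𝕜 := ℂ) u
  rw [RCLike.re_to_complex] at h2 hI ⊢
  rw [inner_sub_right, inner_smul_right, Complex.sub_re,
    show (1 / 2 : ℂ) = ((1 / 2 : ℝ) : ℂ) by norm_num, Complex.re_ofReal_mul, h2, h0] at hI
  linarith

theorem re_inner_profile_le (q : ℂ[X]) :
    RCLike.re (inner ℂ (profile q) (-profile (euler q))) ≤ 1 / 2 * ‖profile q‖ ^ 2 :=
  re_inner_le_of_isLtilde (isLtilde_profile q)

theorem iterate_derivative_euler (m : ℕ) (q : ℂ[X]) :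
    derivative^[m] (euler q) = euler (derivative^[m] q) + (m : ℂ) • derivative^[m] q := by
  induction m with
  | zero => simp
  | succ m ih =>
    rw [Function.iterate_succ_apply', ih, Function.iterate_succ_apply', map_add, map_smul, euler]
    simp only [LinearMap.comp_apply, LinearMap.mulLeft_apply, derivative_mul, derivative_X]
    push_cast
    rw [add_smul]
    simp only [one_mul, one_smul]
    abel

/-- Add the estimates in `𝓗` for `q` and for its `2k`-th derivative. Since `D^{2k}` commutes with
the Euler operator up to `2k D^{2k}`, the error is `-2k‖D^{2k}u‖²` and can be dropped. -/
theorem re_inner_profileK_le (k : ℕ) (q : ℂ[X]) :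
    RCLike.re (inner ℂ (profileK k q) (-profileK k (euler q))) ≤ 1 / 2 * ‖profileK k q‖ ^ 2 := by
  have h1 := re_inner_profile_le q
  have h2 := re_inner_profile_le (derivative^[2 * k] q)
  set r := derivative^[2 * k] q with hr
  have e : -profile (derivative^[2 * k] (euler q)) =
      -profile (euler r) - (((2 * k : ℕ) : ℝ) : ℂ) • profile r := by
    rw [iterate_derivative_euler, map_add, map_smul, neg_add, ← sub_eq_add_neg,
      Complex.ofReal_natCast]
  have h3 := inner_self_eq_norm_sq (𝕜 := ℂ) (profile r)
  rw [norm_sq_hSpace, inner_def, map_neg, map_neg, incl_profileK, incl_profileK, D2k_profileK,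
    D2k_profileK, e, inner_sub_right, inner_smul_right, map_add]
  rw [RCLike.re_to_complex] at h1 h2 h3 ⊢
  rw [RCLike.re_to_complex, Complex.sub_re, Complex.re_ofReal_mul, h3]
  have : 0 ≤ ((2 * k : ℕ) : ℝ) * ‖profile r‖ ^ 2 := by positivity
  linarith

/-! ### Closability of `L̃₀` and closedness of `L_{0,k}` -/

theorem isClosable_Ltilde : Ltilde.IsClosable := by
  refine isClosable_of_re_inner_le (c := 1 / 2) ?_ fun u v h =>
    re_inner_le_of_isLtilde (mem_Ltilde_graph.1 h)
  refine Dense.mono ?_ denseRange_profile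
  rintro _ ⟨q, rfl⟩
  exact LinearPMap.mem_domain_iff.2 ⟨_, mem_Ltilde_graph.2 (isLtilde_profile q)⟩

/-- The dissipativity estimate passes to the closure and yields `‖u‖² ≤ ½‖u‖²`. -/
theorem eq_zero_of_mem_L0_graph {u : H} (h : (u, u) ∈ L0.graph) : u = 0 := by
  rw [L0, ← isClosable_Ltilde.graph_closure_eq_closure_graph] at h
  have h1 := re_inner_le_of_mem_closure (c := 1 / 2)
    (fun p hp => re_inner_le_of_isLtilde (mem_Ltilde_graph.1 hp)) h
  rw [inner_self_eq_norm_sq] at h1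
  exact norm_eq_zero.1 (by nlinarith [norm_nonneg u])

/-- The graph is the preimage of the closed graph of `L₀` under the continuous inclusion in both
factors. -/
theorem isClosed_L0k (k : ℕ) : (L0k k).IsClosed := by
  have h : ((L0k k).graph : Set (HSpace k × HSpace k)) =
      (fun p => (incl k p.1, incl k p.2)) ⁻¹' (L0.graph : Set (H × H)) :=
    Set.ext fun p => mem_L0k_graph
  rw [LinearPMap.IsClosed, h]
  exact isClosable_Ltilde.closure_isClosed.preimage
    (((continuous_incl k).comp continuous_fst).prodMk ((continuous_incl k).comp continuous_snd))

theorem mem_L0k_graph_profileK (k : ℕ) (q : ℂ[X]) :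
    (profileK k q, -profileK k (euler q)) ∈ (L0k k).graph := by
  rw [mem_L0k_graph, map_neg, incl_profileK, incl_profileK, L0]
  exact LinearPMap.le_graph_of_le Ltilde.le_closure (mem_Ltilde_graph.2 (isLtilde_profile q))

end Sobolev

end SimWave

end

theorem proposition3p2 (k : ℕ) :
    SimWave.Ltilde.IsClosable ∧ CompleteSpace (SimWave.HSpace k) ∧
    ∃ S : ℝ≥0 → SimWave.HSpace k →L[ℂ] SimWave.HSpace k,
      SimWave.IsC0Semigroup S ∧ SimWave.IsGenerator (SimWave.L0k k) S ∧
      ∀ τ : ℝ≥0, ‖S τ‖ ≤ Real.exp ((τ : ℝ) / 2) := by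
  have := SimWave.completeSpace_hSpace k
  refine ⟨SimWave.isClosable_Ltilde, this, SimWave.exists_semigroup_of_euler
    (SimWave.denseRange_profileK k) (SimWave.re_inner_profileK_le k) (SimWave.isClosed_L0k k)
    (SimWave.mem_L0k_graph_profileK k) fun u hu => ?_⟩
  exact SimWave.incl_injective k ((SimWave.eq_zero_of_mem_L0_graph
    (SimWave.mem_L0k_graph.1 hu)).trans (map_zero _).symm)
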